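/- Let $R$ be a ring and $N\in\mathbb N$. An $N$-complex of $R$-modules is a diagram $\cdots\to X^i\xrightarrow{d}X^{i+1}\to\cdots$ $(i\in\mathbb Z)$ of $R$-modules with $d^N=0$; let $\mathrm C_N(\mathrm{Mod}_R)$ be the category of $N$-complexes. Put $H^i_{(r)}(X)=\ker(d^r\colon X^i\to X^{i+r})/\operatorname{im}(d^{N-r}\colon X^{i-N+r}\to X^i)$ for $1\le r\le N-1$ and $i\in\mathbb Z$. A morphism is an $N$-quasi-isomorphism if it induces isomorphisms on all $H^i_{(r)}$, and $X$ is acyclic if all $H^i_{(r)}(X)$ vanish; let $W$ be the class of $N$-quasi-isomorphisms and $\mathrm C_N(\mathrm{Mod}_R)[W^{-1}]$ the Gabriel–Zisman localization. Let $\mathcal S_\oplus$ be the class of levelwise split short exact sequences of $N$-complexes, and let $\mathrm K_N(\mathrm{Mod}_R)$ be the stable category: it has the same objects as $\mathrm C_N(\mathrm{Mod}_R)$, and its morphisms are the morphisms of $N$-complexes modulo those that factor through an object which is both projective and injective with respect to $\mathcal S_\oplus$. It is triangulated, the distinguished triangles being, up to isomorphism, those induced by the sequences in $\mathcal S_\oplus$.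 The derived category $\mathrm D_N(\mathrm{Mod}_R)$ is the Verdier quotient of $\mathrm K_N(\mathrm{Mod}_R)$ by the acyclic objects, i.e. the localization of $\mathrm K_N(\mathrm{Mod}_R)$ at the morphisms with acyclic cone. Let $\mathrm{h\text{-}proj}_N(\mathrm{Mod}_R)\subset \mathrm K_N(\mathrm{Mod}_R)$ be the full subcategory of those $X$ with $\mathrm K_N(\mathrm{Mod}_R)(X,Y)=0$ for all acyclic $Y$. Finally, consider on $\mathrm C_N(\mathrm{Mod}_R)$ the model structure whose weak equivalences are the $N$-quasi-isomorphisms, whose fibrations are the levelwise epimorphisms and whose cofibrations are the morphisms with the left lifting property with respect to all levelwise epimorphic $N$-quasi-isomorphisms. Let $\mathrm C_N(\mathrm{Mod}_R)^{cf}$ be its full subcategory of fibrant-cofibrant objects and $\mathrm C_N(\mathrm{Mod}_R)^{cf}/{\sim}$ the quotient by the homotopy relation of the model structure. Then there are canonical equivalences of categories $$\mathrm D_N(\mathrm{Mod}_R)\xleftarrow{\ \sim\ }\mathrm{h\text{-}proj}_N(\mathrm{Mod}_R)\xleftarrow{\ \sim\ }\mathrm C_N(\mathrm{Mod}_R)^{cf}/{\sim}\xrightarrow{\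 \sim\ }\mathrm C_N(\mathrm{Mod}_R)[W^{-1}].$$ Precisely: 1. the composite of the inclusion $\mathrm{h\text{-}proj}_N(\mathrm{Mod}_R)\to\mathrm K_N(\mathrm{Mod}_R)$ with the quotient functor $\mathrm K_N(\mathrm{Mod}_R)\to\mathrm D_N(\mathrm{Mod}_R)$ is an equivalence; 2. the composite of the inclusion $\mathrm C_N(\mathrm{Mod}_R)^{cf}\to\mathrm C_N(\mathrm{Mod}_R)$ with the projection $\mathrm C_N(\mathrm{Mod}_R)\to\mathrm K_N(\mathrm{Mod}_R)$ takes values in $\mathrm{h\text{-}proj}_N(\mathrm{Mod}_R)$ and induces a functor $\mathrm C_N(\mathrm{Mod}_R)^{cf}/{\sim}\to\mathrm{h\text{-}proj}_N(\mathrm{Mod}_R)$, which is an equivalence; 3. the composite of the inclusion $\mathrm C_N(\mathrm{Mod}_R)^{cf}\to\mathrm C_N(\mathrm{Mod}_R)$ with the localization functor induces a functor $\mathrm C_N(\mathrm{Mod}_R)^{cf}/{\sim}\to\mathrm C_N(\mathrm{Mod}_R)[W^{-1}]$, which is an equivalence. In particular, $\mathrm D_N(\mathrm{Mod}_R)$ is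 the Gabriel–Zisman localization of $\mathrm C_N(\mathrm{Mod}_R)$ at the $N$-quasi-isomorphisms: the canonical functor $\mathrm C_N(\mathrm{Mod}_R)\to\mathrm K_N(\mathrm{Mod}_R)\to\mathrm D_N(\mathrm{Mod}_R)$ exhibits $\mathrm D_N(\mathrm{Mod}_R)$ as the localization at $W$. -/

import Mathlib

open CategoryTheory Limits HomotopicalAlgebra
open scoped ZeroObject

universe v u

noncomputable section

/-! ### `N`-complexes

An `∞`-complex `⋯ → Xⁱ → Xⁱ⁺¹ → ⋯` in `A` is a functor `X : ℤ ⥤ A` from the ordered set `ℤ`; the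
`r`-fold composition `dʳ : Xⁱ ⟶ Xⁱ⁺ʳ` of the differential is the value of `X` at `i ≤ i + r`. -/

section NComplexes

variable (A : Type u) [Category.{v} A] [Preadditive A] (N : ℕ)

/-- An `∞`-complex `X` is an `N`-complex if `d ^ N = 0`. -/
def isNComplex : ObjectProperty (ℤ ⥤ A) := fun X =>
  ∀ i : ℤ, X.map (homOfLE (show i ≤ i + (N : ℤ) by lia)) = 0

/-- The category `C_N(A)` of `N`-complexes in `A`, a full subcategory of the category of
`∞`-complexes. -/
abbrev NComplex := (isNComplex A N).FullSubcategory

variable {A N} in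
lemma isNComplex.map_eq_zero {X : ℤ ⥤ A} (hX : isNComplex A N X) {i j : ℤ} (f : i ⟶ j)
    (h : i + (N : ℤ) = j) : X.map f = 0 := by
  subst h
  exact hX i

/-- `N`-complexes are closed under the (levelwise) limits of `∞`-complexes. -/
instance isNComplex_closedUnderLimits (J : Type*) [Category* J] [HasLimitsOfShape J A] :
    (isNComplex A N).IsClosedUnderLimitsOfShape J where
  limitsOfShape_le := by
    rintro X ⟨p⟩ i
    have hl := isLimitOfPreserves ((evaluation ℤ A).obj (i + (N : ℤ))) p.isLimit
    refine hl.hom_ext fun j => ?_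
    have h := (p.π.app j).naturality (homOfLE (show i ≤ i + (N : ℤ) by lia))
    have h' := p.prop_diag_obj j i
    dsimp at h ⊢
    rw [h, h']
    simp

instance NComplex.instHasFiniteProducts [HasFiniteProducts A] :
    HasFiniteProducts (NComplex A N) where
  out _ := inferInstance

instance NComplex.instHasFiniteBiproducts [HasFiniteProducts A] :
    HasFiniteBiproducts (NComplex A N) :=
  HasFiniteBiproducts.of_hasFiniteProducts

/-- The functor `X ↦ Xⁱ`. -/
def NComplex.eval (i : ℤ) : NComplex A N ⥤ A :=
  (isNComplex A N).ι ⋙ (evaluation ℤ A).obj i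

instance (i : ℤ) : (NComplex.eval A N i).Additive where
  map_add := rfl

end NComplexes

/-! ### The homotopy category -/

section Homotopy

variable (A : Type u) [Category.{v} A] [Preadditive A] (N : ℕ)

variable {A N} in
/-- The class `S_⊕` of levelwise split short exact sequences of `N`-complexes. -/
def NComplex.LevelwiseSplit (S : ShortComplex (NComplex A N)) : Prop :=
  ∀ i : ℤ, Nonempty (S.map (NComplex.eval A N i)).Splitting

variable {A N} in
/-- `P` is projective with respect to `S_⊕`. -/
def NComplex.IsSplitProjective (P : NComplex A N) : Prop :=
  ∀ (S : ShortComplex (NComplex A N)), NComplex.LevelwiseSplit S →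
    ∀ f : P ⟶ S.X₃, ∃ g : P ⟶ S.X₂, g ≫ S.g = f

variable {A N} in
/-- `I` is injective with respect to `S_⊕`. -/
def NComplex.IsSplitInjective (I : NComplex A N) : Prop :=
  ∀ (S : ShortComplex (NComplex A N)), NComplex.LevelwiseSplit S →
    ∀ f : S.X₁ ⟶ I, ∃ g : S.X₂ ⟶ I, S.f ≫ g = f

/-- `f` and `g` are identified if `f - g` factors through an object which is both projective and
injective with respect to `S_⊕`. -/
def NComplex.stableRel : HomRel (NComplex A N) := fun X Y f g =>
  ∃ (P : NComplex A N) (_ : P.IsSplitProjective) (_ : P.IsSplitInjective)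
    (a : X ⟶ P) (b : P ⟶ Y), a ≫ b = f - g

/-- The morphisms that factor through a projective-injective object form a two-sided ideal. -/
instance [HasFiniteProducts A] : Congruence (NComplex.stableRel A N) := by
  have : HasZeroObject (NComplex A N) := hasZeroObject_of_hasFiniteBiproducts _
  have : HasBinaryBiproducts (NComplex A N) := hasBinaryBiproducts_of_finite_biproducts _
  exact
  { comp_left := by
      rintro X Y Z f g g' ⟨P, h₁, h₂, a, b, h⟩
      exact ⟨P, h₁, h₂, f ≫ a, b, by rw [Category.assoc, h, Preadditive.comp_sub]⟩
    comp_right := by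
      rintro X Y Z f f' g ⟨P, h₁, h₂, a, b, h⟩
      exact ⟨P, h₁, h₂, a, b ≫ g, by rw [← Category.assoc, h, Preadditive.sub_comp]⟩
    equivalence := fun {X Y} =>
    { refl := fun f => by
        refine ⟨0, fun S _ f => ⟨0, (isZero_zero _).eq_of_src _ _⟩,
          fun S _ f => ⟨0, (isZero_zero _).eq_of_tgt _ _⟩, 0, 0, by simp⟩
      symm := by
        rintro f g ⟨P, h₁, h₂, a, b, h⟩
        exact ⟨P, h₁, h₂, -a, b, by rw [Preadditive.neg_comp, h, neg_sub]⟩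
      trans := by
        rintro f g k ⟨P, h₁, h₂, a, b, h⟩ ⟨P', h₁', h₂', a', b', h'⟩
        refine ⟨P ⊞ P', fun S hS l => ?_, fun S hS l => ?_, biprod.lift a a', biprod.desc b b', ?_⟩
        · obtain ⟨m, hm⟩ := h₁ S hS (biprod.inl ≫ l)
          obtain ⟨m', hm'⟩ := h₁' S hS (biprod.inr ≫ l)
          exact ⟨biprod.desc m m', by
            apply biprod.hom_ext' <;> simp [hm, hm']⟩
        · obtain ⟨m, hm⟩ := h₂ S hS (l ≫ biprod.fst)
          obtain ⟨m', hm'⟩ := h₂' S hS (l ≫ biprod.snd)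
          exact ⟨biprod.lift m m', by
            apply biprod.hom_ext <;> simp [hm, hm']⟩
        · rw [biprod.lift_desc, h, h', sub_add_sub_cancel] } }

/-- The homotopy category `K_N(A)`: the stable category of `C_N(A)` with respect to `S_⊕`. -/
abbrev NComplex.K := CategoryTheory.Quotient (NComplex.stableRel A N)

/-- The projection `C_N(A) ⥤ K_N(A)`. -/
abbrev NComplex.toK : NComplex A N ⥤ NComplex.K A N :=
  CategoryTheory.Quotient.functor (NComplex.stableRel A N)

variable {A N} in
/-- `X ⟶ Y ⟶ Z` are the first two morphisms of a distinguished triangle `X ⟶ Y ⟶ Z ⟶ ΣX` of the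
triangulated category `K_N(A)`, so that `Z` is a cone of `f`: up to isomorphism in `K_N(A)` they
come from a levelwise split short exact sequence of `N`-complexes. -/
def NComplex.IsConeSequence {X Y Z : NComplex.K A N} (f : X ⟶ Y) (g : Y ⟶ Z) : Prop :=
  ∃ (S : ShortComplex (NComplex A N)) (_ : NComplex.LevelwiseSplit S)
    (a : X ≅ (NComplex.toK A N).obj S.X₁) (b : Y ≅ (NComplex.toK A N).obj S.X₂)
    (c : Z ≅ (NComplex.toK A N).obj S.X₃),
    f ≫ b.hom = a.hom ≫ (NComplex.toK A N).map S.f ∧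
    g ≫ c.hom = b.hom ≫ (NComplex.toK A N).map S.g

end Homotopy

/-! ### Cohomology, the derived category and h-projective `N`-complexes -/

section Derived

variable (A : Type u) [Category.{v} A] [Abelian A] (N : ℕ)

/-- The sequence `Xⁱ⁻⁽ᴺ⁻ʳ⁾ ⟶ Xⁱ ⟶ Xⁱ⁺ʳ` with the morphisms `dᴺ⁻ʳ` and `dʳ`. -/
def NComplex.sequence (r : ℕ) (hr : r < N) (i : ℤ) : NComplex A N ⥤ ShortComplex A where
  obj X := ShortComplex.mk
    (X.obj.map (homOfLE (show i - ((N : ℤ) - r) ≤ i by lia)))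
    (X.obj.map (homOfLE (show i ≤ i + (r : ℤ) by lia)))
    (by
      rw [← X.obj.map_comp]
      exact X.property.map_eq_zero _ (by lia))
  map f :=
    { τ₁ := f.hom.app _
      τ₂ := f.hom.app _
      τ₃ := f.hom.app _ }

/-- The cohomology functor `H_(r)ⁱ(X) = ker (dʳ) / im (dᴺ⁻ʳ)` in degree `i`
(used for `1 ≤ r ≤ N - 1`). -/
def NComplex.cohomology (r : ℕ) (hr : r < N) (i : ℤ) : NComplex A N ⥤ A :=
  NComplex.sequence A N r hr i ⋙ ShortComplex.homologyFunctor A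

/-- The class `W` of `N`-quasi-isomorphisms. -/
def NComplex.quasiIso : MorphismProperty (NComplex A N) := fun _ _ f =>
  ∀ (r : ℕ) (_ : 1 ≤ r) (hr : r < N) (i : ℤ), IsIso ((NComplex.cohomology A N r hr i).map f)

variable {A N} in
/-- An `N`-complex is acyclic if all its cohomology objects vanish. -/
def NComplex.Acyclic (X : NComplex A N) : Prop :=
  ∀ (r : ℕ) (_ : 1 ≤ r) (hr : r < N) (i : ℤ), IsZero ((NComplex.cohomology A N r hr i).obj X)

/-- The morphisms of `K_N(A)` that have an acyclic cone. -/
def NComplex.acyclicCone : MorphismProperty (NComplex.K A N) := fun _ Y f =>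
  ∃ (Z : NComplex.K A N) (g : Y ⟶ Z), NComplex.IsConeSequence f g ∧ Z.as.Acyclic

/-- The derived category `D_N(A)`: the Verdier quotient of `K_N(A)` by the acyclic `N`-complexes,
i.e. the localization of `K_N(A)` at the morphisms that have an acyclic cone. -/
abbrev NComplex.D := (NComplex.acyclicCone A N).Localization

/-- The quotient functor `K_N(A) ⥤ D_N(A)`. -/
abbrev NComplex.toD : NComplex.K A N ⥤ NComplex.D A N := (NComplex.acyclicCone A N).Q

/-- `X` is h-projective if every morphism in `K_N(A)` from `X` to an acyclic object is trivial. -/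
def NComplex.isHProj : ObjectProperty (NComplex.K A N) := fun X =>
  ∀ Y : NComplex.K A N, Y.as.Acyclic → Subsingleton (X ⟶ Y)

/-- The full subcategory `h-proj_N(A)` of `K_N(A)`. -/
abbrev NComplex.HProj := (NComplex.isHProj A N).FullSubcategory

/-- The inclusion `h-proj_N(A) ⥤ K_N(A)`. -/
abbrev NComplex.hProjι : NComplex.HProj A N ⥤ NComplex.K A N := (NComplex.isHProj A N).ι

/-! ### The (projective) model structure and its homotopy category -/

/-- The weak equivalences are the `N`-quasi-isomorphisms. -/
instance NComplex.instWeakEquivalences : CategoryWithWeakEquivalences (NComplex A N) where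
  weakEquivalences := NComplex.quasiIso A N

/-- The fibrations are the levelwise epimorphisms. -/
instance NComplex.instFibrations : CategoryWithFibrations (NComplex A N) where
  fibrations := fun _ _ f => ∀ i : ℤ, Epi ((NComplex.eval A N i).map f)

/-- The cofibrations are the morphisms with the left lifting property with respect to all
trivial fibrations. -/
instance NComplex.instCofibrations : CategoryWithCofibrations (NComplex A N) where
  cofibrations := (trivialFibrations (NComplex A N)).llp

/-- The full subcategory `C_N(A)^{cf}` of fibrant-cofibrant objects. -/
abbrev NComplex.CF := BifibrantObject (NComplex A N)

/-- The inclusion `C_N(A)^{cf} ⥤ C_N(A)`. -/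
abbrev NComplex.cfι : NComplex.CF A N ⥤ NComplex A N := (bifibrantObjects (NComplex A N)).ι

/-- The homotopy relation on morphisms between fibrant-cofibrant objects: there are a factorization
`Y ⟶ P ⟶ Y × Y` of the diagonal into a weak equivalence followed by a fibration and a
morphism `X ⟶ P` whose two components are the given morphisms. -/
def NComplex.cfHomotopic : HomRel (NComplex.CF A N) := fun _ Y f g =>
  ∃ P : PathObject Y.obj, P.IsGood ∧ Nonempty (P.RightHomotopy f.hom g.hom)

/-- The category `C_N(A)^{cf} / ∼`. -/
abbrev NComplex.Ho := CategoryTheory.Quotient (NComplex.cfHomotopic A N)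

/-- The projection `C_N(A)^{cf} ⥤ C_N(A)^{cf} / ∼`. -/
abbrev NComplex.toHo : NComplex.CF A N ⥤ NComplex.Ho A N :=
  CategoryTheory.Quotient.functor (NComplex.cfHomotopic A N)

end Derived

end

/-! Everything rests on the contractible complexes `disk N M`. A morphism into such a complex is an
arbitrary family of linear maps `Xⁱ → M i`, and a morphism out of it is an arbitrary family `M i →
Yⁱ⁺¹⁻ᴺ`. It is therefore injective and projective for levelwise split sequences, and it is acyclic.
Every `Y` is a levelwise split quotient of one, via `fromContractible Y`. Hence `f` and `g` are
stably equal iff `f - g` lifts through `fromContractible Y` (`stableRel_iff_exists_lift`), and such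
a lift is a right homotopy for the path object `Y ⊞ disk`.

Right homotopic morphisms agree in any category where quasi-isomorphisms are inverted. Since the
quasi-isomorphisms are exactly the preimage in `K` of the morphisms with acyclic cone
(`quasiIso_eq_inverseImage`), localizing `C_N` is the same as localizing `K`.

For h-projective `P`, `K(P, -)` inverts the morphisms with acyclic cone
(`acyclicCone_le_isColocal`). Cofibrant objects are h-projective, and the small object argument
supplies a cofibrant replacement of every object. So h-projectives form a coreflective subcategory
whose coreflection is the localization (`isEquivalence_ι_comp_Q`). On cofibrant sources right
homotopy is stable equality, which identifies `Ho` with `HProj`; the last equivalence is a composite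
of the others. Neither the triangulated structure nor the full model axioms are needed. -/

noncomputable section

namespace NComplex

variable {R : Type u} [Ring R] {N : ℕ}

/-! ### Differentials and morphisms of `N`-complexes on elements -/

section Elements

variable {X Y Z : NComplex (ModuleCat.{u} R) N}

/-- The iterated differential `Xⁱ → Xʲ` as a linear map. -/
def d (X : NComplex (ModuleCat.{u} R) N) {i j : ℤ} (h : i ≤ j) :
    X.obj.obj i →ₗ[R] X.obj.obj j :=
  (X.obj.map (homOfLE h)).hom

/-- The component of a morphism in degree `i` as a linear map. -/
def app (f : X ⟶ Y) (i : ℤ) : X.obj.obj i →ₗ[R] Y.obj.obj i :=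
  (f.hom.app i).hom

@[simp]
lemma d_self {i : ℤ} (h : i ≤ i) (x : X.obj.obj i) : X.d h x = x := by
  simp [d]

@[simp]
lemma d_d {i j k : ℤ} (h : i ≤ j) (h' : j ≤ k) (x : X.obj.obj i) :
    X.d h' (X.d h x) = X.d (h.trans h') x := by
  have := X.obj.map_comp (homOfLE h) (homOfLE h')
  exact congr(($this).hom x).symm

lemma d_eq_zero {i j : ℤ} (h : i ≤ j) (hij : i + N ≤ j) (x : X.obj.obj i) : X.d h x = 0 := by
  rw [← d_d (show i ≤ i + N by lia) hij x]
  have : X.d (show i ≤ i + N by lia) x = 0 := by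
    simp [d, X.property i]
  simp [this]

@[simp]
lemma app_d (f : X ⟶ Y) {i j : ℤ} (h : i ≤ j) (x : X.obj.obj i) :
    app f j (X.d h x) = Y.d h (app f i x) := by
  have := congr_arg ModuleCat.Hom.hom (f.hom.naturality (homOfLE h))
  exact LinearMap.congr_fun this x

@[simp]
lemma app_id (i : ℤ) (x : X.obj.obj i) : app (𝟙 X) i x = x := rfl

@[simp]
lemma app_comp (f : X ⟶ Y) (g : Y ⟶ Z) (i : ℤ) (x : X.obj.obj i) :
    app (f ≫ g) i x = app g i (app f i x) := rfl

@[simp]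
lemma app_zero (i : ℤ) (x : X.obj.obj i) : app (0 : X ⟶ Y) i x = 0 := rfl

@[simp]
lemma app_add (f g : X ⟶ Y) (i : ℤ) (x : X.obj.obj i) :
    app (f + g) i x = app f i x + app g i x := rfl

@[simp]
lemma app_sub (f g : X ⟶ Y) (i : ℤ) (x : X.obj.obj i) :
    app (f - g) i x = app f i x - app g i x := rfl

lemma hom_ext_app {f g : X ⟶ Y} (h : ∀ i x, app f i x = app g i x) : f = g := by
  ext i x
  exact h i x

/-- The morphism of `N`-complexes with given components. -/
def homMk (φ : ∀ i, X.obj.obj i →ₗ[R] Y.obj.obj i)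
    (h : ∀ (i j : ℤ) (hij : i ≤ j) (x : X.obj.obj i), φ j (X.d hij x) = Y.d hij (φ i x)) :
    X ⟶ Y :=
  ObjectProperty.homMk
    { app i := ModuleCat.ofHom (φ i)
      naturality i j f := by
        ext x
        exact h i j (leOfHom f) x }

@[simp]
lemma app_homMk (φ : ∀ i, X.obj.obj i →ₗ[R] Y.obj.obj i) (h) (i : ℤ) (x : X.obj.obj i) :
    app (homMk φ h) i x = φ i x := rfl

/-- The `N`-complex with given objects and iterated differentials. -/
def objMk (N : ℕ) (M : ℤ → ModuleCat.{u} R) (δ : ∀ ⦃i j : ℤ⦄, i ≤ j → M i →ₗ[R] M j)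
    (h₁ : ∀ i x, δ (le_refl i) x = x)
    (h₂ : ∀ (i j k : ℤ) (h : i ≤ j) (h' : j ≤ k) x, δ (h.trans h') x = δ h' (δ h x))
    (h₃ : ∀ (i : ℤ) (h : i ≤ i + N) x, δ h x = 0) : NComplex (ModuleCat.{u} R) N where
  obj :=
    { obj := M
      map f := ModuleCat.ofHom (δ (leOfHom f))
      map_id i := by
        ext x
        exact h₁ i x
      map_comp f g := by
        ext x
        exact h₂ _ _ _ (leOfHom f) (leOfHom g) x }
  property i := by
    ext x
    exact h₃ i _ x

end Elements

/-! ### Cohomology in terms of elements -/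

section ShortComplex

variable {S T : ShortComplex (ModuleCat.{u} R)} (φ : S ⟶ T)

/-- An element is a morphism from `R`; conversely, chosen preimages become linear after covering a
test module by the free module on its elements. -/
lemma mono_homologyMap_iff :
    Mono (ShortComplex.homologyMap φ) ↔ ∀ (x : S.X₂) (y : T.X₁), S.g x = 0 → φ.τ₂ x = T.f y →
      ∃ z : S.X₁, x = S.f z := by
  rw [ShortComplex.mono_homologyMap_iff_up_to_refinements]
  refine ⟨fun h x y hx hxy => ?_, fun h A x hx y hxy => ?_⟩
  · obtain ⟨A, π, hπ, z, hz⟩ := h (ModuleCat.ofHom (LinearMap.toSpanSingleton R S.X₂ x))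
      (by ext; simpa using hx) (ModuleCat.ofHom (LinearMap.toSpanSingleton R T.X₁ y))
      (by ext; simpa using hxy)
    obtain ⟨a, ha⟩ := (ModuleCat.epi_iff_surjective π).1 hπ (1 : R)
    refine ⟨z a, ?_⟩
    have := congr($hz a)
    simpa [ha] using this
  · have h' (a : A) : ∃ z : S.X₁, x a = S.f z :=
      h (x a) (y a) congr($hx a) congr($hxy a)
    choose z hz using h'
    refine ⟨ModuleCat.of R (A →₀ R), ModuleCat.ofHom (Finsupp.linearCombination R id), ?_,
      ModuleCat.ofHom (Finsupp.linearCombination R z), ?_⟩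
    · rw [ModuleCat.epi_iff_surjective]
      exact Finsupp.linearCombination_id_surjective R A
    · ext a
      simp [hz]

lemma epi_homologyMap_iff :
    Epi (ShortComplex.homologyMap φ) ↔ ∀ y : T.X₂, T.g y = 0 →
      ∃ (x : S.X₂) (z : T.X₁), S.g x = 0 ∧ y = φ.τ₂ x + T.f z := by
  rw [ShortComplex.epi_homologyMap_iff_up_to_refinements]
  refine ⟨fun h y hy => ?_, fun h A y hy => ?_⟩
  · obtain ⟨A, π, hπ, x, hx, z, hz⟩ := h (ModuleCat.ofHom (LinearMap.toSpanSingleton R T.X₂ y))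
      (by ext; simpa using hy)
    obtain ⟨a, ha⟩ := (ModuleCat.epi_iff_surjective π).1 hπ (1 : R)
    refine ⟨x a, z a, congr($hx a), ?_⟩
    have := congr($hz a)
    simpa [ha] using this
  · have h' (a : A) : ∃ (x : S.X₂) (z : T.X₁), S.g x = 0 ∧ y a = φ.τ₂ x + T.f z :=
      h (y a) congr($hy a)
    choose x z hx hz using h'
    refine ⟨ModuleCat.of R (A →₀ R), ModuleCat.ofHom (Finsupp.linearCombination R id), ?_,
      ModuleCat.ofHom (Finsupp.linearCombination R x), ?_,
      ModuleCat.ofHom (Finsupp.linearCombination R z), ?_⟩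
    · rw [ModuleCat.epi_iff_surjective]
      exact Finsupp.linearCombination_id_surjective R A
    · ext a
      simp [hx]
    · ext a
      simp [hz]

end ShortComplex

section Cohomology

variable {X Y : NComplex (ModuleCat.{u} R) N}

/-- Windows `a < b < c = a + N` replace `(r, i)` by `r = c - b`, `i = b`. Chases can then move to
the windows `b, c, b + N` and `b - N, a, b`, which exchange `r` and `N - r`. -/
lemma acyclic_iff :
    X.Acyclic ↔ ∀ (a b c : ℤ) (hab : a < b) (hbc : b < c) (_ : c = a + N) (x : X.obj.obj b),
      X.d hbc.le x = 0 → ∃ y : X.obj.obj a, x = X.d hab.le y := by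
  refine ⟨fun h a b c hab hbc hac x hx => ?_, fun h r hr hrN i => ?_⟩
  · obtain ⟨r, rfl⟩ : ∃ r : ℕ, c = b + r := ⟨(c - b).toNat, by lia⟩
    obtain rfl : a = b - ((N : ℤ) - r) := by lia
    have h' := h r (by lia) (by lia) b
    have h'' := (ShortComplex.exact_iff_isZero_homology _).2 h'
    rw [ShortComplex.moduleCat_exact_iff] at h''
    obtain ⟨y, hy⟩ := h'' x hx
    exact ⟨y, hy.symm⟩
  · refine (ShortComplex.exact_iff_isZero_homology _).1 ?_
    rw [ShortComplex.moduleCat_exact_iff]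
    intro x hx
    obtain ⟨y, hy⟩ := h (i - ((N : ℤ) - r)) i (i + r) (by lia) (by lia) (by lia) x hx
    exact ⟨y, hy.symm⟩

lemma quasiIso_iff (f : X ⟶ Y) :
    quasiIso _ N f ↔ ∀ (a b c : ℤ) (hab : a < b) (hbc : b < c) (_ : c = a + N),
      (∀ (x : X.obj.obj b) (y : Y.obj.obj a), X.d hbc.le x = 0 → app f b x = Y.d hab.le y →
        ∃ z : X.obj.obj a, x = X.d hab.le z) ∧
      (∀ y : Y.obj.obj b, Y.d hbc.le y = 0 →
        ∃ (x : X.obj.obj b) (z : Y.obj.obj a), X.d hbc.le x = 0 ∧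
          y = app f b x + Y.d hab.le z) := by
  refine ⟨fun h a b c hab hbc hac => ?_, fun h r hr hrN i => ?_⟩
  · obtain ⟨r, rfl⟩ : ∃ r : ℕ, c = b + r := ⟨(c - b).toNat, by lia⟩
    obtain rfl : a = b - ((N : ℤ) - r) := by lia
    have h' : IsIso (ShortComplex.homologyMap ((sequence (ModuleCat.{u} R) N r _ b).map f)) :=
      h r (by lia) (by lia) b
    exact ⟨(mono_homologyMap_iff ((sequence (ModuleCat.{u} R) N r _ b).map f)).1 inferInstance,
      (epi_homologyMap_iff ((sequence (ModuleCat.{u} R) N r _ b).map f)).1 inferInstance⟩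
  · have h' := h (i - ((N : ℤ) - r)) i (i + r) (by lia) (by lia) (by lia)
    have := (mono_homologyMap_iff ((sequence (ModuleCat.{u} R) N r hrN i).map f)).2 h'.1
    have := (epi_homologyMap_iff ((sequence (ModuleCat.{u} R) N r hrN i).map f)).2 h'.2
    exact isIso_of_mono_of_epi (ShortComplex.homologyMap _)

lemma quasiIso_of_acyclic (f : X ⟶ Y) (hX : X.Acyclic) (hY : Y.Acyclic) : quasiIso _ N f :=
  fun r hr hrN i => ⟨0, (hX r hr hrN i).eq_of_src _ _, (hY r hr hrN i).eq_of_src _ _⟩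

end Cohomology

/-! ### Levelwise split sequences in terms of elements -/

section Split

variable {S : ShortComplex (NComplex (ModuleCat.{u} R) N)}

lemma app_g_app_f (S : ShortComplex (NComplex (ModuleCat.{u} R) N)) (i : ℤ)
    (x : S.X₁.obj.obj i) : app S.g i (app S.f i x) = 0 := by
  rw [← app_comp, S.zero, app_zero]

lemma map_eval_exact {i : ℤ}
    (h : ∀ x : S.X₂.obj.obj i, app S.g i x = 0 → ∃ y, app S.f i y = x) :
    (S.map (eval (ModuleCat.{u} R) N i)).Exact := by
  rw [ShortComplex.moduleCat_exact_iff]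
  exact h

lemma levelwiseSplit_of_section
    (s : ∀ i, S.X₃.obj.obj i →ₗ[R] S.X₂.obj.obj i) (hs : ∀ i x, app S.g i (s i x) = x)
    (hf : ∀ i, Function.Injective (app S.f i))
    (h : ∀ i (x : S.X₂.obj.obj i), app S.g i x = 0 → ∃ y, app S.f i y = x) :
    LevelwiseSplit S := fun i => by
  have : Mono (S.map (eval (ModuleCat.{u} R) N i)).f := (ModuleCat.mono_iff_injective _).2 (hf i)
  exact ⟨.ofExactOfSection _ (map_eval_exact (h i)) (ModuleCat.ofHom (s i))
    (by ext x; exact hs i x) inferInstance⟩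

lemma levelwiseSplit_of_retraction
    (ρ : ∀ i, S.X₂.obj.obj i →ₗ[R] S.X₁.obj.obj i) (hρ : ∀ i x, ρ i (app S.f i x) = x)
    (hg : ∀ i, Function.Surjective (app S.g i))
    (h : ∀ i (x : S.X₂.obj.obj i), app S.g i x = 0 → ∃ y, app S.f i y = x) :
    LevelwiseSplit S := fun i => by
  have : Epi (S.map (eval (ModuleCat.{u} R) N i)).g := (ModuleCat.epi_iff_surjective _).2 (hg i)
  exact ⟨.ofExactOfRetraction _ (map_eval_exact (h i)) (ModuleCat.ofHom (ρ i))
    (by ext x; exact hρ i x) inferInstance⟩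

namespace LevelwiseSplit

variable (hS : LevelwiseSplit S)

include hS

lemma exists_section (i : ℤ) :
    ∃ s : S.X₃.obj.obj i →ₗ[R] S.X₂.obj.obj i, ∀ x, app S.g i (s x) = x := by
  obtain ⟨σ⟩ := hS i
  exact ⟨σ.s.hom, fun x => congr(($(σ.s_g)).hom x)⟩

lemma exists_retraction (i : ℤ) :
    ∃ ρ : S.X₂.obj.obj i →ₗ[R] S.X₁.obj.obj i, ∀ x, ρ (app S.f i x) = x := by
  obtain ⟨σ⟩ := hS i
  exact ⟨σ.r.hom, fun x => congr(($(σ.f_r)).hom x)⟩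

lemma injective (i : ℤ) : Function.Injective (app S.f i) := by
  obtain ⟨ρ, hρ⟩ := hS.exists_retraction i
  exact Function.LeftInverse.injective hρ

lemma surjective (i : ℤ) : Function.Surjective (app S.g i) := by
  obtain ⟨s, h⟩ := hS.exists_section i
  exact fun x => ⟨_, h x⟩

lemma exact (i : ℤ) (x : S.X₂.obj.obj i) (hx : app S.g i x = 0) : ∃ y, app S.f i y = x := by
  obtain ⟨σ⟩ := hS i
  have := σ.exact
  rw [ShortComplex.moduleCat_exact_iff] at this
  exact this x hx

lemma exists_lift {W : NComplex (ModuleCat.{u} R) N} (k : W ⟶ S.X₂) (hk : k ≫ S.g = 0) :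
    ∃ l : W ⟶ S.X₁, l ≫ S.f = k := by
  have h (i : ℤ) (x : W.obj.obj i) : app S.g i (app k i x) = 0 := by
    rw [← app_comp, hk, app_zero]
  choose ρ hρ using hS.exists_retraction
  have hρ' (i : ℤ) (x : W.obj.obj i) : app S.f i (ρ i (app k i x)) = app k i x := by
    obtain ⟨y, hy⟩ := hS.exact i _ (h i x)
    rw [← hy, hρ]
  -- The `ρ i` need not commute with the differentials; compatibility is tested after the injective
  -- `S.f`.
  refine ⟨homMk (fun i => ρ i ∘ₗ app k i) fun i j hij x => hS.injective j ?_,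
    hom_ext_app fun i x => ?_⟩
  · rw [LinearMap.comp_apply, hρ', app_d, app_d, LinearMap.comp_apply, hρ']
  · rw [app_comp, app_homMk, LinearMap.comp_apply, hρ']

end LevelwiseSplit

end Split

/-! ### Contractible `N`-complexes -/

section Disk

variable (N) in
/-- The elements of `∏ Mᵢ` that are supported in `[j, j + N)`. -/
def diskSubmodule (M : ℤ → ModuleCat.{u} R) (j : ℤ) : Submodule R (∀ i, M i) where
  carrier := {m | ∀ i, ¬ (j ≤ i ∧ i < j + N) → m i = 0}
  add_mem' h h' i hi := by simp [h i hi, h' i hi]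
  zero_mem' i hi := rfl
  smul_mem' r m h i hi := by simp [h i hi]

variable (N) in
/-- The linear projection of `∏ Mᵢ` onto the elements that are supported in `[j, j + N)`. -/
def diskCut (M : ℤ → ModuleCat.{u} R) (j : ℤ) : (∀ i, M i) →ₗ[R] diskSubmodule N M j where
  toFun m := ⟨fun i => if j ≤ i ∧ i < j + N then m i else 0, fun i hi => by simp [hi]⟩
  map_add' m m' := by
    ext i
    by_cases h : j ≤ i ∧ i < j + N <;> simp [h]
  map_smul' r m := by
    ext i
    by_cases h : j ≤ i ∧ i < j + N <;> simp [h]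

lemma diskCut_apply (M : ℤ → ModuleCat.{u} R) (j : ℤ) (m : ∀ i, M i) (i : ℤ) :
    (diskCut N M j m).1 i = if j ≤ i ∧ i < j + N then m i else 0 := rfl

variable (N) in
/-- The contractible `N`-complex given by the elements of `∏ Mᵢ` that are supported in `[j, j + N)`
in degree `j`; the differential restricts the support. -/
def disk (M : ℤ → ModuleCat.{u} R) : NComplex (ModuleCat.{u} R) N :=
  objMk N (fun j => ModuleCat.of R (diskSubmodule N M j))
    (fun i j _ => diskCut N M j ∘ₗ (diskSubmodule N M i).subtype)
    (fun i x => by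
      ext k
      have := x.2 k
      by_cases h : i ≤ k ∧ k < i + N
      · simp [diskCut_apply, h]
      · simp [diskCut_apply, h, this h])
    (fun i j k hij hjk x => by
      ext l
      have := x.2 l
      by_cases h : k ≤ l ∧ l < k + N
      · by_cases h' : j ≤ l ∧ l < j + N
        · simp [diskCut_apply, h, h']
        · have := this (by lia)
          simp [diskCut_apply, this]
      · simp [diskCut_apply, h])
    (fun i h x => by
      ext l
      have := x.2 l
      by_cases h : i + N ≤ l ∧ l < i + N + N
      · simp [diskCut_apply, this (by lia)]
      · simp [diskCut_apply, h])

variable {M : ℤ → ModuleCat.{u} R} {X Y : NComplex (ModuleCat.{u} R) N}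

/-- The components of an element of a contractible `N`-complex. -/
def diskProj (M : ℤ → ModuleCat.{u} R) (i j : ℤ) : (disk N M).obj.obj j →ₗ[R] M i :=
  LinearMap.proj i ∘ₗ (diskSubmodule N M j).subtype

/-- The element of a contractible `N`-complex with the given components. -/
def diskElem (N : ℕ) (M : ℤ → ModuleCat.{u} R) (j : ℤ) :
    (∀ i, M i) →ₗ[R] (disk N M).obj.obj j :=
  diskCut N M j

lemma diskProj_diskElem (i j : ℤ) (m : ∀ i, M i) :
    diskProj M i j (diskElem N M j m) = if j ≤ i ∧ i < j + N then m i else 0 := rfl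

lemma disk_ext {j : ℤ} {x y : (disk N M).obj.obj j}
    (h : ∀ i, j ≤ i → i < j + N → diskProj M i j x = diskProj M i j y) : x = y := by
  apply Subtype.ext
  funext i
  by_cases hi : j ≤ i ∧ i < j + N
  · exact h i hi.1 hi.2
  · rw [x.2 i hi, y.2 i hi]

lemma diskProj_eq_zero (i j : ℤ) (x : (disk N M).obj.obj j) (h : ¬ (j ≤ i ∧ i < j + N)) :
    diskProj M i j x = 0 :=
  x.2 i h

lemma diskProj_d {i j : ℤ} (hij : i ≤ j) (x : (disk N M).obj.obj i) (k : ℤ) (hk : j ≤ k) :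
    diskProj M k j ((disk N M).d hij x) = diskProj M k i x := by
  change (if j ≤ k ∧ k < j + N then diskProj M k i x else 0) = _
  by_cases h : k < j + N
  · simp [h, hk]
  · rw [diskProj_eq_zero k i x (by lia), ite_self]

/-- The morphism into a contractible `N`-complex with given coordinates. -/
def toDisk (φ : ∀ i, X.obj.obj i →ₗ[R] M i) : X ⟶ disk N M :=
  homMk (fun j => diskElem N M j ∘ₗ
      LinearMap.pi fun i => if h : j ≤ i then φ i ∘ₗ X.d h else 0)
    (fun i j hij x => disk_ext fun k hk hk' => by
      rw [diskProj_d hij _ _ hk]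
      simp only [LinearMap.comp_apply, diskProj_diskElem, LinearMap.pi_apply, hk, hk', and_self,
        if_true, dif_pos, d_d, hij.trans hk, true_and]
      split_ifs with h
      · rfl
      -- Here `k ≥ i + N`: the component lies outside the window of degree `i`, and `d ^ N = 0`
      -- kills it in degree `j` as well.
      · rw [d_eq_zero _ (by lia), map_zero])

lemma diskProj_toDisk (φ : ∀ i, X.obj.obj i →ₗ[R] M i) (i : ℤ) (x : X.obj.obj i) :
    diskProj M i i (app (toDisk φ) i x) = φ i x := by
  simp only [toDisk, app_homMk, LinearMap.comp_apply, diskProj_diskElem, LinearMap.pi_apply,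
    le_refl, dif_pos, d_self, true_and]
  split_ifs with h
  · rfl
  · rw [← d_self le_rfl x, d_eq_zero _ (by lia), map_zero]

/-- The `i`-th component in degree `j ≤ i` is unchanged by the differential to degree `i`, so the
diagonal components determine a morphism. -/
lemma toDisk_hom_ext {f g : X ⟶ disk N M}
    (h : ∀ i x, diskProj M i i (app f i x) = diskProj M i i (app g i x)) : f = g :=
  hom_ext_app fun j x => disk_ext fun i hi hi' => by
    rw [← diskProj_d hi _ i le_rfl, ← diskProj_d hi (app g j x) i le_rfl, ← app_d, ← app_d, h]

/-- The morphism from a contractible `N`-complex given by the images of the generators. -/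
def fromDisk (ψ : ∀ i : ℤ, M i →ₗ[R] Y.obj.obj (i + 1 - N)) : disk N M ⟶ Y :=
  homMk (fun j => ∑ i ∈ Finset.Ico j (j + N),
      if h : i + 1 - N ≤ j then Y.d h ∘ₗ ψ i ∘ₗ diskProj M i j else 0)
    (fun i j hij x => by
      simp only [LinearMap.sum_apply, map_sum]
      -- Both sums are extended by zeros to the common range `[i, j + N)` and then compared
      -- termwise.
      have h₁ := Finset.sum_subset (f := fun k =>
          (if h : k + 1 - N ≤ j then Y.d h ∘ₗ ψ k ∘ₗ diskProj M k j else 0)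
            ((disk N M).d hij x))
        (show Finset.Ico j (j + N) ⊆ Finset.Ico i (j + N) from
          Finset.Ico_subset_Ico hij le_rfl)
        (fun k hk hk' => by
          simp only [Finset.mem_Ico] at hk hk'
          split_ifs
          · simp [diskProj_eq_zero k j _ (by lia)]
          · rfl)
      have h₂ := Finset.sum_subset (f := fun k =>
          Y.d hij ((if h : k + 1 - N ≤ i then Y.d h ∘ₗ ψ k ∘ₗ diskProj M k i else 0) x))
        (show Finset.Ico i (i + N) ⊆ Finset.Ico i (j + N) from
          Finset.Ico_subset_Ico le_rfl (by lia))
        (fun k hk hk' => by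
          simp only [Finset.mem_Ico] at hk hk'
          split_ifs
          · simp [diskProj_eq_zero k i _ (by lia)]
          · simp)
      rw [h₁, h₂]
      refine Finset.sum_congr rfl fun k hk => ?_
      simp only [Finset.mem_Ico] at hk
      by_cases hjk : j ≤ k
      · by_cases hki : k + 1 - N ≤ i
        · simp [hki, hki.trans hij, diskProj_d hij x k hjk]
        · rw [dif_neg hki]
          have := diskProj_eq_zero k i x (by lia)
          split_ifs <;> simp [diskProj_d hij x k hjk, this]
      -- For `k < j` the component is cut off in the disk, while in `Y` the differential from `k + 1
      -- - N` to `j` has at least `N` steps.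
      · have := diskProj_eq_zero k j ((disk N M).d hij x) (by lia)
        split_ifs with h h'
        · simp [this, d_eq_zero (X := Y) (show k + 1 - N ≤ j by lia) (by lia)]
        · simp [this]
        · simp [d_eq_zero (X := Y) (show k + 1 - N ≤ j by lia) (by lia)]
        · simp)

/-- The inclusions of the generators in a contractible `N`-complex. -/
def diskGen (N : ℕ) (M : ℤ → ModuleCat.{u} R) (i : ℤ) :
    M i →ₗ[R] (disk N M).obj.obj (i + 1 - N) :=
  diskElem N M (i + 1 - N) ∘ₗ LinearMap.single R (fun i => M i) i

/-- For `N ≥ 1`, `i` is the last index in the window of degree `i + 1 - N`; for `N = 0` the window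
is empty, whence the condition `hj`. -/
lemma diskProj_diskGen (i : ℤ) (j : ℤ) (m : M i) (hj : i = j → 1 ≤ N) :
    diskProj M j (i + 1 - N) (diskGen N M i m) = Pi.single (M := fun i => M i) i m j := by
  simp only [diskGen, LinearMap.comp_apply, diskProj_diskElem, LinearMap.single_apply]
  by_cases h : i = j
  · have := hj h
    rw [if_pos (by lia)]
  · rw [Pi.single_eq_of_ne (Ne.symm h), ite_self]

lemma app_fromDisk (ψ : ∀ i : ℤ, M i →ₗ[R] Y.obj.obj (i + 1 - N)) (j : ℤ)
    (x : (disk N M).obj.obj j) :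
    app (fromDisk ψ) j x = ∑ i ∈ Finset.Ico j (j + N),
      if h : i + 1 - N ≤ j then Y.d h (ψ i (diskProj M i j x)) else 0 := by
  simp only [fromDisk, app_homMk, LinearMap.sum_apply]
  refine Finset.sum_congr rfl fun k _ => ?_
  split_ifs <;> rfl

lemma fromDisk_comp {Z : NComplex (ModuleCat.{u} R) N}
    (ψ : ∀ i : ℤ, M i →ₗ[R] Y.obj.obj (i + 1 - N)) (g : Y ⟶ Z) :
    fromDisk ψ ≫ g = fromDisk (fun i => app g (i + 1 - N) ∘ₗ ψ i) :=
  hom_ext_app fun i x => by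
    simp only [app_comp, app_fromDisk, map_sum]
    refine Finset.sum_congr rfl fun k _ => ?_
    split_ifs <;> simp

lemma fromDisk_diskGen : fromDisk (diskGen N M) = 𝟙 (disk N M) :=
  toDisk_hom_ext fun i x => by
    simp only [app_fromDisk, map_sum, app_id]
    by_cases hN : N = 0
    · rw [diskProj_eq_zero i i x (by lia)]
      simp [hN]
    · rw [Finset.sum_eq_single i]
      · rw [dif_pos (by lia), diskProj_d _ _ _ le_rfl, diskProj_diskGen _ _ _ (by lia)]
        simp
      · intro k hk hki
        split_ifs
        · rw [diskProj_d _ _ _ le_rfl, diskProj_diskGen _ _ _ (by lia),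
            Pi.single_eq_of_ne hki.symm]
        · simp
      · intro h
        simp at h
        lia

lemma eq_fromDisk (f : disk N M ⟶ Y) :
    f = fromDisk (fun i => app f (i + 1 - N) ∘ₗ diskGen N M i) := by
  rw [← fromDisk_comp, fromDisk_diskGen, Category.id_comp]

variable (N M) in
-- Levelwise retractions suffice, because the family of linear maps defining a morphism into a disk
-- obeys no compatibility.
lemma disk_isSplitInjective : (disk N M).IsSplitInjective := fun S hS f => by
  choose ρ hρ using hS.exists_retraction
  refine ⟨toDisk fun i => diskProj M i i ∘ₗ app f i ∘ₗ ρ i, toDisk_hom_ext fun i x => ?_⟩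
  rw [app_comp, diskProj_toDisk]
  simp [hρ]

variable (N M) in
lemma disk_isSplitProjective : (disk N M).IsSplitProjective := fun S hS f => by
  choose s hs using hS.exists_section
  refine ⟨fromDisk fun i => s _ ∘ₗ app f (i + 1 - N) ∘ₗ diskGen N M i, ?_⟩
  rw [fromDisk_comp]
  conv_rhs => rw [eq_fromDisk f]
  congr 1
  ext i m
  exact hs _ _

variable (N M) in
-- A cycle in degree `b` is supported in `[b, c)`, hence in the window `[a, a + N)`; the same family
-- in degree `a` is a preimage.
lemma disk_acyclic : (disk N M).Acyclic :=
  acyclic_iff.2 fun a b c hab hbc hac x hx => by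
    refine ⟨diskElem N M a fun i => diskProj M i b x, disk_ext fun i hi hi' => ?_⟩
    rw [diskProj_d _ _ _ hi, diskProj_diskElem]
    split_ifs with h
    · rfl
    · rw [← diskProj_d hbc.le x i (by lia), hx, map_zero]

/-- The levelwise split monomorphism from an `N`-complex to a contractible one. -/
def toContractible (X : NComplex (ModuleCat.{u} R) N) : X ⟶ disk N X.obj.obj :=
  toDisk fun _ => LinearMap.id

lemma diskProj_toContractible (i : ℤ) (x : X.obj.obj i) :
    diskProj X.obj.obj i i (app (toContractible X) i x) = x :=
  diskProj_toDisk _ i x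

/-- The levelwise split epimorphism to an `N`-complex from a contractible one. -/
def fromContractible (Y : NComplex (ModuleCat.{u} R) N) :
    disk N (fun i => Y.obj.obj (i + 1 - N)) ⟶ Y :=
  fromDisk fun _ => LinearMap.id

lemma exists_section_fromContractible (Y : NComplex (ModuleCat.{u} R) N) (j : ℤ) :
    ∃ s : Y.obj.obj j →ₗ[R] (disk N (fun i => Y.obj.obj (i + 1 - N))).obj.obj j,
      ∀ y, app (fromContractible Y) j (s y) = y := by
  -- In the window of degree `j` only `i = j + N - 1` satisfies `j ≤ i + 1 - N`, and then with
  -- equality. Using `d` there avoids a transport along that equality.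
  refine ⟨diskElem N _ j ∘ₗ LinearMap.pi fun i => if h : j ≤ i + 1 - N then Y.d h else 0,
    fun y => ?_⟩
  rw [fromContractible, app_fromDisk]
  by_cases hN : N = 0
  · rw [← d_self le_rfl y, d_eq_zero _ (by lia)]
    simp
  · rw [Finset.sum_eq_single (j + N - 1)]
    · rw [dif_pos (by lia), LinearMap.comp_apply, diskProj_diskElem, if_pos (by lia),
        LinearMap.pi_apply, dif_pos (by lia)]
      simp
    · intro k hk hkj
      split_ifs
      · rw [LinearMap.comp_apply, diskProj_diskElem]
        split_ifs
        · rw [LinearMap.pi_apply, dif_neg (by lia)]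
          simp
        · simp
      · simp
    · intro h
      simp at h
      lia

end Disk

/-! ### Kernels and cokernels -/

section KernelCokernel

variable {X Y : NComplex (ModuleCat.{u} R) N}

/-- The levelwise kernel of a morphism. -/
def kerObj (g : X ⟶ Y) : NComplex (ModuleCat.{u} R) N :=
  objMk N (fun i => ModuleCat.of R (LinearMap.ker (app g i)))
    (fun i j h => (X.d h).restrict fun x hx => by
      rw [LinearMap.mem_ker] at hx ⊢
      rw [app_d, hx, map_zero])
    (fun i x => Subtype.ext (d_self _ _))
    (fun i j k h h' x => Subtype.ext (d_d _ _ _).symm)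
    (fun i h x => Subtype.ext (d_eq_zero _ le_rfl _))

/-- The inclusion of the levelwise kernel. -/
def kerι (g : X ⟶ Y) : kerObj g ⟶ X :=
  homMk (fun i => (LinearMap.ker (app g i)).subtype) (fun _ _ _ _ => rfl)

/-- The levelwise cokernel of a morphism. -/
def cokerObj (f : X ⟶ Y) : NComplex (ModuleCat.{u} R) N :=
  objMk N (fun i => ModuleCat.of R (Y.obj.obj i ⧸ LinearMap.range (app f i)))
    (fun i j h => Submodule.mapQ _ _ (Y.d h) (by
      rintro _ ⟨x, rfl⟩
      exact ⟨X.d h x, app_d f h x⟩))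
    (fun i x => by
      obtain ⟨x, rfl⟩ := Submodule.Quotient.mk_surjective _ x
      simp)
    (fun i j k h h' x => by
      obtain ⟨x, rfl⟩ := Submodule.Quotient.mk_surjective _ x
      simp)
    (fun i h x => by
      obtain ⟨x, rfl⟩ := Submodule.Quotient.mk_surjective _ x
      simp [d_eq_zero])

/-- The projection to the levelwise cokernel. -/
def cokerπ (f : X ⟶ Y) : Y ⟶ cokerObj f :=
  homMk (fun i => Submodule.mkQ (LinearMap.range (app f i))) (fun _ _ _ _ => rfl)

/-- The sequence `ker g ⟶ X ⟶ Y`. -/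
@[simps]
def kerSequence (g : X ⟶ Y) : ShortComplex (NComplex (ModuleCat.{u} R) N) where
  X₁ := kerObj g
  X₂ := X
  X₃ := Y
  f := kerι g
  g := g
  zero := hom_ext_app fun _ x => x.2

/-- The sequence `X ⟶ Y ⟶ coker f`. -/
@[simps]
def cokerSequence (f : X ⟶ Y) : ShortComplex (NComplex (ModuleCat.{u} R) N) where
  X₁ := X
  X₂ := Y
  X₃ := cokerObj f
  f := f
  g := cokerπ f
  zero := hom_ext_app fun _ x => (Submodule.Quotient.mk_eq_zero _).2 ⟨x, rfl⟩

lemma levelwiseSplit_kerSequence (g : X ⟶ Y)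
    (h : ∀ i, ∃ s : Y.obj.obj i →ₗ[R] X.obj.obj i, ∀ y, app g i (s y) = y) :
    LevelwiseSplit (kerSequence g) := by
  choose s hs using h
  exact levelwiseSplit_of_section s hs (fun i => Subtype.val_injective)
    (fun i x hx => ⟨⟨x, hx⟩, rfl⟩)

lemma levelwiseSplit_cokerSequence (f : X ⟶ Y)
    (h : ∀ i, ∃ ρ : Y.obj.obj i →ₗ[R] X.obj.obj i, ∀ x, ρ (app f i x) = x) :
    LevelwiseSplit (cokerSequence f) := by
  choose ρ hρ using h
  exact levelwiseSplit_of_retraction ρ hρ (fun i => Submodule.mkQ_surjective (LinearMap.range (app f i)))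
    (fun i x hx => (Submodule.Quotient.mk_eq_zero _).1 hx)

variable (Y) in
lemma levelwiseSplit_fromContractible :
    LevelwiseSplit (kerSequence (fromContractible Y)) :=
  levelwiseSplit_kerSequence _ (exists_section_fromContractible Y)

end KernelCokernel

/-! ### Acyclic `N`-complexes and `N`-quasi-isomorphisms -/

section Acyclic

variable {X Y Z : NComplex (ModuleCat.{u} R) N}

instance : (quasiIso (ModuleCat.{u} R) N).HasTwoOutOfThreeProperty where
  comp_mem f g hf hg r hr hrN i := by
    have := hf r hr hrN i
    have := hg r hr hrN i
    rw [Functor.map_comp]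
    infer_instance
  of_postcomp f g hg hfg r hr hrN i := by
    have := hg r hr hrN i
    have h := hfg r hr hrN i
    rw [Functor.map_comp] at h
    exact IsIso.of_isIso_comp_right _ ((cohomology (ModuleCat.{u} R) N r hrN i).map g)
  of_precomp f g hf hfg r hr hrN i := by
    have := hf r hr hrN i
    have h := hfg r hr hrN i
    rw [Functor.map_comp] at h
    exact IsIso.of_isIso_comp_left ((cohomology (ModuleCat.{u} R) N r hrN i).map f) _

lemma Acyclic.of_quasiIso {f : X ⟶ Y} (hf : quasiIso _ N f) (hY : Y.Acyclic) : X.Acyclic :=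
  fun r hr hrN i => by
    have := hf r hr hrN i
    exact (hY r hr hrN i).of_iso (asIso ((cohomology (ModuleCat.{u} R) N r hrN i).map f))

lemma Acyclic.of_retract {i : X ⟶ Y} {r : Y ⟶ X} (h : i ≫ r = 𝟙 X) (hY : Y.Acyclic) :
    X.Acyclic :=
  acyclic_iff.2 fun a b c hab hbc hac x hx => by
    obtain ⟨y, hy⟩ := acyclic_iff.1 hY a b c hab hbc hac (app i b x) (by rw [← app_d, hx, map_zero])
    refine ⟨app r a y, ?_⟩
    rw [← app_d, ← hy, ← app_comp, h, app_id]

variable {S : ShortComplex (NComplex (ModuleCat.{u} R) N)} (hS : LevelwiseSplit S)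

include hS

namespace LevelwiseSplit

/-- A chase in place of the long exact sequence: injectivity uses acyclicity in the window `b - N,
a, b`, where `S.g y` is a cycle, and surjectivity uses the window `a, b, c`. -/
lemma quasiIso_f (h₃ : S.X₃.Acyclic) : quasiIso _ N S.f := by
  rw [acyclic_iff] at h₃
  refine (quasiIso_iff _).2 fun a b c hab hbc hac => ⟨fun x y hx hxy => ?_, fun y hy => ?_⟩
  · obtain ⟨w, hw⟩ := h₃ (b - N) a b (by lia) hab (by lia) (app S.g a y)
      (by rw [← app_d, ← hxy, app_g_app_f])
    obtain ⟨w, rfl⟩ := hS.surjective _ w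
    obtain ⟨v, hv⟩ := hS.exact a (y - S.X₂.d (by lia) w) (by
      rw [map_sub, app_d, ← hw, sub_self])
    refine ⟨v, hS.injective b ?_⟩
    rw [app_d, hv, hxy, map_sub, d_d, d_eq_zero (show b - N ≤ b by lia) (by lia), sub_zero]
  · obtain ⟨z, hz⟩ := h₃ a b c hab hbc hac (app S.g b y) (by rw [← app_d, hy, map_zero])
    obtain ⟨z, rfl⟩ := hS.surjective _ z
    obtain ⟨x, hx⟩ := hS.exact b (y - S.X₂.d hab.le z) (by rw [map_sub, app_d, ← hz, sub_self])
    refine ⟨x, z, hS.injective c ?_, by rw [hx, sub_add_cancel]⟩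
    rw [app_d, hx, map_sub, hy, d_d, d_eq_zero (show a ≤ c by lia) hac.ge, sub_zero, map_zero]

/-- Injectivity in the window `b, c, b + N` corrects a lift `y` to a cycle by an element of `S.X₁`;
surjectivity in `a, b, c` makes it a boundary modulo `S.X₁`. -/
lemma acyclic_X₃ (hf : quasiIso _ N S.f) : S.X₃.Acyclic := by
  rw [quasiIso_iff] at hf
  refine acyclic_iff.2 fun a b c hab hbc hac z hz => ?_
  obtain ⟨y, rfl⟩ := hS.surjective _ z
  obtain ⟨x, hx⟩ := hS.exact c (S.X₂.d hbc.le y) (by rw [app_d, hz])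
  obtain ⟨v, hv⟩ := (hf b c (b + N) hbc (by lia) rfl).1 x y
    (hS.injective _ (by rw [app_d, hx, d_d, d_eq_zero _ le_rfl, map_zero])) hx
  obtain ⟨w, t, -, hwt⟩ := (hf a b c hab hbc hac).2 (y - app S.f b v)
    (by rw [map_sub, ← app_d, ← hv, hx, sub_self])
  refine ⟨app S.g a t, ?_⟩
  rw [← app_d, ← sub_eq_iff_eq_add'.2 hwt, map_sub, map_sub, app_g_app_f, app_g_app_f, sub_zero,
    sub_zero]

lemma acyclic_X₁ (h₂ : S.X₂.Acyclic) (h₃ : S.X₃.Acyclic) : S.X₁.Acyclic :=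
  .of_quasiIso (hS.quasiIso_f h₃) h₂

end LevelwiseSplit

end Acyclic

/-- `K` serves as the desuspension of `Y`. -/
lemma exists_kernel_fromContractible (Y : NComplex (ModuleCat.{u} R) N) :
    ∃ (K : NComplex (ModuleCat.{u} R) N) (ι : K ⟶ disk N (fun i => Y.obj.obj (i + 1 - N))),
      ι ≫ fromContractible Y = 0 ∧
      (∀ {W : NComplex (ModuleCat.{u} R) N} (k : W ⟶ disk N (fun i => Y.obj.obj (i + 1 - N))),
        k ≫ fromContractible Y = 0 → ∃ l, l ≫ ι = k) ∧
      (Y.Acyclic → K.Acyclic) :=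
  ⟨_, _, (kerSequence (fromContractible Y)).zero,
    fun k hk => (levelwiseSplit_fromContractible Y).exists_lift k hk,
    fun hY => (levelwiseSplit_fromContractible Y).acyclic_X₁ (disk_acyclic N _) hY⟩

/-! ### Morphisms in the homotopy category -/

section Stable

variable {X Y Z : NComplex (ModuleCat.{u} R) N}

lemma toK_map_eq_iff (f g : X ⟶ Y) :
    (toK _ N).map f = (toK _ N).map g ↔ stableRel _ N f g :=
  Quotient.functor_map_eq_iff _ _ _

lemma stableRel_add_left (k : X ⟶ Y) {f g : X ⟶ Y} (h : stableRel _ N f g) :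
    stableRel _ N (k + f) (k + g) := by
  obtain ⟨P, h₁, h₂, a, b, hab⟩ := h
  exact ⟨P, h₁, h₂, a, b, by rw [hab, add_sub_add_left_eq_sub]⟩

lemma stableRel_zero_add {f g : X ⟶ Y} (hf : stableRel _ N f 0) (hg : stableRel _ N g 0) :
    stableRel _ N (f + g) 0 :=
  (Congruence.equivalence).trans (by simpa using stableRel_add_left f hg) hf

lemma stableRel_zero_comp_right {f : X ⟶ Y} (hf : stableRel _ N f 0) (g : Y ⟶ Z) :
    stableRel _ N (f ≫ g) 0 := by
  obtain ⟨P, h₁, h₂, a, b, hab⟩ := hf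
  exact ⟨P, h₁, h₂, a, b ≫ g, by rw [← Category.assoc, hab, sub_zero, sub_zero]⟩

lemma stableRel_of_comp_eq (f g : X ⟶ Y) {M : ℤ → ModuleCat.{u} R} (a : X ⟶ disk N M)
    (b : disk N M ⟶ Y) (h : a ≫ b = f - g) : stableRel _ N f g :=
  ⟨_, disk_isSplitProjective N M, disk_isSplitInjective N M, a, b, h⟩

lemma IsSplitProjective.exists_lift_fromContractible {P : NComplex (ModuleCat.{u} R) N}
    (hP : P.IsSplitProjective) (b : P ⟶ Y) : ∃ c, c ≫ fromContractible Y = b :=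
  hP _ (levelwiseSplit_fromContractible Y) b

lemma IsSplitProjective.acyclic {P : NComplex (ModuleCat.{u} R) N} (hP : P.IsSplitProjective) :
    P.Acyclic := by
  obtain ⟨c, hc⟩ := hP.exists_lift_fromContractible (𝟙 P)
  exact .of_retract hc (disk_acyclic N _)

/-- Any split projective object over `Y` lifts through `fromContractible Y`, so this single object
tests the relation. -/
lemma stableRel_iff_exists_lift (f g : X ⟶ Y) :
    stableRel _ N f g ↔ ∃ a, a ≫ fromContractible Y = f - g := by
  refine ⟨?_, fun ⟨a, ha⟩ => stableRel_of_comp_eq f g a _ ha⟩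
  rintro ⟨P, h₁, h₂, a, b, h⟩
  obtain ⟨c, hc⟩ := h₁.exists_lift_fromContractible b
  exact ⟨a ≫ c, by rw [Category.assoc, hc, h]⟩

/-- The difference factors through an acyclic object, so stably equal morphisms agree on cohomology.
-/
lemma exists_app_sub_of_stableRel {f g : X ⟶ Y} (h : stableRel _ N f g) (a b c : ℤ) (hab : a < b)
    (hbc : b < c) (hac : c = a + N) (x : X.obj.obj b) (hx : X.d hbc.le x = 0) :
    ∃ y, app f b x - app g b x = Y.d hab.le y := by
  obtain ⟨P, h₁, -, k, l, h⟩ := h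
  obtain ⟨y, hy⟩ := acyclic_iff.1 h₁.acyclic a b c hab hbc hac (app k b x)
    (by rw [← app_d, hx, map_zero])
  refine ⟨app l a y, ?_⟩
  rw [← app_sub, ← h, app_comp, hy, app_d]

lemma quasiIso_of_stableRel {f g : X ⟶ Y} (h : stableRel _ N f g) (hf : quasiIso _ N f) :
    quasiIso _ N g := by
  rw [quasiIso_iff] at hf ⊢
  refine fun a b c hab hbc hac => ⟨fun x y hx hxy => ?_, fun y hy => ?_⟩
  · obtain ⟨z, hz⟩ := exists_app_sub_of_stableRel h a b c hab hbc hac x hx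
    exact (hf a b c hab hbc hac).1 x (z + y) hx (by rw [map_add, ← hz, ← hxy, sub_add_cancel])
  · obtain ⟨x, z, hx, rfl⟩ := (hf a b c hab hbc hac).2 y hy
    obtain ⟨w, hw⟩ := exists_app_sub_of_stableRel h a b c hab hbc hac x hx
    exact ⟨x, w + z, hx, by rw [map_add, ← hw]; abel⟩

lemma quasiIso_id (X : NComplex (ModuleCat.{u} R) N) : quasiIso _ N (𝟙 X) := fun r hr hrN i => by
  rw [CategoryTheory.Functor.map_id]
  infer_instance

/-- With `g` representing the inverse, `f ≫ g` gives injectivity on cohomology and `g ≫ f` gives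
surjectivity. -/
lemma quasiIso_of_isIso_toK (f : X ⟶ Y) [IsIso ((toK (ModuleCat.{u} R) N).map f)] :
    quasiIso _ N f := by
  obtain ⟨g, hg⟩ := (toK (ModuleCat.{u} R) N).map_surjective (inv ((toK _ N).map f))
  have h₁ : quasiIso _ N (f ≫ g) := quasiIso_of_stableRel
    ((toK_map_eq_iff (𝟙 X) (f ≫ g)).1 (by simp [hg])) (quasiIso_id X)
  have h₂ : quasiIso _ N (g ≫ f) := quasiIso_of_stableRel
    ((toK_map_eq_iff (𝟙 Y) (g ≫ f)).1 (by simp [hg])) (quasiIso_id Y)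
  rw [quasiIso_iff] at h₁ h₂ ⊢
  refine fun a b c hab hbc hac => ⟨fun x y hx hxy => ?_, fun y hy => ?_⟩
  · exact (h₁ a b c hab hbc hac).1 x (app g a y) hx (by rw [app_comp, hxy, app_d])
  · obtain ⟨x, z, hx, hxz⟩ := (h₂ a b c hab hbc hac).2 y hy
    exact ⟨app g b x, z, by rw [← app_d, hx, map_zero], hxz⟩

end Stable

/-! ### Morphisms with an acyclic cone -/

section Cone

variable {X Y Z : NComplex (ModuleCat.{u} R) N}

lemma Acyclic.of_iso_toK (hY : Y.Acyclic) (e : (toK _ N).obj X ≅ (toK _ N).obj Y) :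
    X.Acyclic := by
  obtain ⟨f, hf⟩ := (toK (ModuleCat.{u} R) N).map_surjective e.hom
  have : IsIso ((toK (ModuleCat.{u} R) N).map f) := by
    rw [hf]
    infer_instance
  exact .of_quasiIso (quasiIso_of_isIso_toK f) hY

instance : HasZeroObject (NComplex (ModuleCat.{u} R) N) :=
  hasZeroObject_of_hasFiniteBiproducts _

instance : HasBinaryBiproducts (NComplex (ModuleCat.{u} R) N) :=
  hasBinaryBiproducts_of_finite_biproducts _

/-- Adding a contractible `N`-complex does not change the isomorphism class in the homotopy
category. -/
def toKBiprodDisk (Y : NComplex (ModuleCat.{u} R) N) (M : ℤ → ModuleCat.{u} R) :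
    (toK _ N).obj Y ≅ (toK _ N).obj (Y ⊞ disk N M) where
  hom := (toK _ N).map biprod.inl
  inv := (toK _ N).map biprod.fst
  hom_inv_id := by simp [← Functor.map_comp]
  inv_hom_id := by
    rw [← Functor.map_comp, ← CategoryTheory.Functor.map_id, toK_map_eq_iff]
    refine stableRel_of_comp_eq _ _ (-biprod.snd) biprod.inr ?_
    rw [← biprod.total, Preadditive.neg_comp]
    abel

/-- Adding `disk N X.obj.obj` to `Y` turns `f` into a levelwise split monomorphism `i` without
changing it in `K`; the cokernel of `i` is the cone. -/
lemma acyclicCone_of_quasiIso (f : X ⟶ Y) (hf : quasiIso _ N f) :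
    acyclicCone _ N ((toK _ N).map f) := by
  let i : X ⟶ Y ⊞ disk N X.obj.obj := biprod.lift f (toContractible X)
  have hi : LevelwiseSplit (cokerSequence i) := levelwiseSplit_cokerSequence _ fun j =>
    ⟨diskProj X.obj.obj j j ∘ₗ app biprod.snd j, fun x => by
      rw [LinearMap.comp_apply, ← app_comp, biprod.lift_snd, diskProj_toContractible]⟩
  have h₁ : quasiIso _ N (biprod.fst : Y ⊞ disk N X.obj.obj ⟶ Y) := by
    have : IsIso ((toK (ModuleCat.{u} R) N).map (biprod.fst : Y ⊞ disk N X.obj.obj ⟶ Y)) :=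
      (toKBiprodDisk Y X.obj.obj).isIso_inv
    exact quasiIso_of_isIso_toK _
  have h₂ : quasiIso _ N i :=
    (quasiIso (ModuleCat.{u} R) N).of_postcomp i biprod.fst h₁ (by rwa [biprod.lift_fst])
  refine ⟨(toK _ N).obj (cokerObj i), (toK _ N).map (biprod.inl ≫ cokerπ i),
    ⟨cokerSequence i, hi, Iso.refl _, toKBiprodDisk Y X.obj.obj, Iso.refl _, ?_, ?_⟩,
    hi.acyclic_X₃ h₂⟩
  · change (toK _ N).map f ≫ (toK _ N).map biprod.inl = 𝟙 _ ≫ (toK _ N).map i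
    rw [Category.id_comp, ← Functor.map_comp, toK_map_eq_iff]
    refine stableRel_of_comp_eq _ _ (-toContractible X) biprod.inr ?_
    apply biprod.hom_ext <;> simp [i]
  · change (toK _ N).map _ ≫ 𝟙 _ = (toK _ N).map biprod.inl ≫ (toK _ N).map (cokerπ i)
    rw [Category.comp_id, Functor.map_comp]

lemma quasiIso_of_acyclicCone (f : X ⟶ Y) (hf : acyclicCone _ N ((toK _ N).map f)) :
    quasiIso _ N f := by
  obtain ⟨Z, g, ⟨S, hS, a, b, c, h₁, -⟩, hZ⟩ := hf
  obtain ⟨a', ha'⟩ := (toK (ModuleCat.{u} R) N).map_surjective a.hom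
  obtain ⟨b', hb'⟩ := (toK (ModuleCat.{u} R) N).map_surjective b.hom
  have : IsIso ((toK (ModuleCat.{u} R) N).map a') := by
    rw [ha']
    infer_instance
  have : IsIso ((toK (ModuleCat.{u} R) N).map b') := by
    rw [hb']
    infer_instance
  rw [← ha', ← hb', ← Functor.map_comp, ← Functor.map_comp, toK_map_eq_iff] at h₁
  have h₂ : quasiIso _ N (a' ≫ S.f) := (quasiIso (ModuleCat.{u} R) N).comp_mem _ _
    (quasiIso_of_isIso_toK a') (hS.quasiIso_f (Acyclic.of_iso_toK (X := S.X₃) (Y := Z.as) hZ c.symm))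
  exact (quasiIso (ModuleCat.{u} R) N).of_postcomp f b' (quasiIso_of_isIso_toK b')
    (quasiIso_of_stableRel (Congruence.equivalence.symm h₁) h₂)

variable (R N) in
lemma quasiIso_eq_inverseImage :
    quasiIso (ModuleCat.{u} R) N =
      (acyclicCone (ModuleCat.{u} R) N).inverseImage (toK (ModuleCat.{u} R) N) := by
  ext X Y f
  exact ⟨acyclicCone_of_quasiIso f, quasiIso_of_acyclicCone f⟩

end Cone

/-! ### Morphisms from h-projective `N`-complexes -/

section HProj

variable {P X Y : NComplex (ModuleCat.{u} R) N}

lemma isHProj_iff :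
    isHProj _ N ((toK _ N).obj P) ↔
      ∀ Y : NComplex (ModuleCat.{u} R) N, Y.Acyclic → ∀ f : P ⟶ Y, stableRel _ N f 0 := by
  refine ⟨fun h Y hY f => ?_, fun h Y hY => ⟨fun f g => ?_⟩⟩
  · have := h ((toK _ N).obj Y) hY
    exact (toK_map_eq_iff _ _).1 (Subsingleton.elim _ _)
  · obtain ⟨f, rfl⟩ := (toK (ModuleCat.{u} R) N).map_surjective (Y := Y.as) f
    obtain ⟨g, rfl⟩ := (toK (ModuleCat.{u} R) N).map_surjective (Y := Y.as) g
    exact (toK_map_eq_iff _ _).2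
      (Congruence.equivalence.trans (h _ hY f) (Congruence.equivalence.symm (h _ hY g)))

variable {S : ShortComplex (NComplex (ModuleCat.{u} R) N)}

namespace LevelwiseSplit

lemma cancel_f (hS : LevelwiseSplit S) {f g : P ⟶ S.X₁} (h : f ≫ S.f = g ≫ S.f) : f = g :=
  hom_ext_app fun i x => hS.injective i (by rw [← app_comp, h, app_comp])

variable (hP : isHProj _ N ((toK _ N).obj P)) (hS : LevelwiseSplit S) (h₃ : S.X₃.Acyclic)

include hP hS h₃

/-- Surjectivity of `K(P, X₁) → K(P, X₂)`: `g ≫ S.g` factors through a projective `I`, and lifting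
`I` to `X₂` gives the correction that moves `g` into `X₁`. -/
lemma exists_stableRel_comp_f (g : P ⟶ S.X₂) : ∃ h : P ⟶ S.X₁, stableRel _ N (h ≫ S.f) g := by
  obtain ⟨I, h₁, h₂, a, b, hab⟩ := isHProj_iff.1 hP _ h₃ (g ≫ S.g)
  obtain ⟨c, hc⟩ := h₁ S hS b
  obtain ⟨l, hl⟩ := hS.exists_lift (g - a ≫ c) (by
    rw [Preadditive.sub_comp, Category.assoc, hc, hab, sub_zero, sub_self])
  exact ⟨l, I, h₁, h₂, -a, c, by rw [hl, Preadditive.neg_comp]; abel⟩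

/-- Injectivity of `K(P, X₁) → K(P, X₂)`: stably, `h` comes from a morphism `k` to the desuspension
`K` of `X₃`, which is acyclic. -/
lemma stableRel_zero_of_comp_f (h : P ⟶ S.X₁) (hh : stableRel _ N (h ≫ S.f) 0) :
    stableRel _ N h 0 := by
  obtain ⟨I, h₁, h₂, a, b, hab⟩ := hh
  rw [sub_zero] at hab
  obtain ⟨K, ι, hι, hlift, hK⟩ := exists_kernel_fromContractible S.X₃
  obtain ⟨c, hc⟩ := h₁.exists_lift_fromContractible (b ≫ S.g)
  obtain ⟨k, hk⟩ := hlift (a ≫ c) (by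
    rw [Category.assoc, hc, ← Category.assoc, hab, Category.assoc, S.zero, comp_zero])
  have hk' := isHProj_iff.1 hP _ (hK h₃) k
  obtain ⟨e, he⟩ := disk_isSplitProjective N _ S hS (fromContractible S.X₃)
  obtain ⟨u, hu⟩ := hS.exists_lift (b - c ≫ e) (by
    rw [Preadditive.sub_comp, Category.assoc, he, hc, sub_self])
  -- `w` is the connecting morphism from the desuspension of `X₃` to `X₁`.
  obtain ⟨w, hw⟩ := hS.exists_lift (ι ≫ e) (by rw [Category.assoc, he, hι])
  obtain rfl : h = a ≫ u + k ≫ w := hS.cancel_f (by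
    rw [Preadditive.add_comp, Category.assoc, Category.assoc, hu, hw, ← Category.assoc k, hk,
      Preadditive.comp_sub, hab, Category.assoc, sub_add_cancel])
  exact stableRel_zero_add ⟨I, h₁, h₂, a, u, by rw [sub_zero]⟩ (stableRel_zero_comp_right hk' w)

end LevelwiseSplit

variable (R N) in
lemma acyclicCone_le_isColocal :
    acyclicCone (ModuleCat.{u} R) N ≤ (isHProj (ModuleCat.{u} R) N).isColocal := by
  rintro X Y w ⟨Z, g, ⟨S, hS, a, b, c, h₁, -⟩, hZ⟩
  have h₃ : S.X₃.Acyclic := Acyclic.of_iso_toK (X := S.X₃) (Y := Z.as) hZ c.symm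
  have h : (isHProj (ModuleCat.{u} R) N).isColocal ((toK _ N).map S.f) := by
    rintro P hP
    refine ⟨fun f f' hff' => ?_, fun f => ?_⟩
    · obtain ⟨f, rfl⟩ := (toK (ModuleCat.{u} R) N).map_surjective (X := P.as) f
      obtain ⟨f', rfl⟩ := (toK (ModuleCat.{u} R) N).map_surjective (X := P.as) f'
      dsimp only at hff'
      rw [← Functor.map_comp, ← Functor.map_comp, toK_map_eq_iff] at hff'
      rw [toK_map_eq_iff]
      obtain ⟨I, i₁, i₂, k, l, hkl⟩ := hff'
      obtain ⟨I, i₁, i₂, k, l, hkl⟩ := LevelwiseSplit.stableRel_zero_of_comp_f (P := P.as) hP hS h₃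
        (f - f') ⟨I, i₁, i₂, k, l, by rw [hkl, Preadditive.sub_comp, sub_zero]⟩
      exact ⟨I, i₁, i₂, k, l, by rw [hkl, sub_zero]⟩
    · obtain ⟨f, rfl⟩ := (toK (ModuleCat.{u} R) N).map_surjective (X := P.as) f
      obtain ⟨l, hl⟩ := LevelwiseSplit.exists_stableRel_comp_f (P := P.as) hP hS h₃ f
      exact ⟨(toK _ N).map l, by
        dsimp only
        rw [← Functor.map_comp]
        exact (toK_map_eq_iff _ _).2 hl⟩
  have hw : w = a.hom ≫ (toK _ N).map S.f ≫ b.inv := by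
    rw [← Category.assoc, ← h₁, Category.assoc, b.hom_inv_id, Category.comp_id]
  rw [hw]
  exact (MorphismProperty.cancel_left_of_respectsIso _ _ _).2
    ((MorphismProperty.cancel_right_of_respectsIso _ _ _).2 h)

end HProj

/-! ### Cofibrant `N`-complexes -/

section Cofibrant

variable {X Y : NComplex (ModuleCat.{u} R) N}

lemma fibrations_iff (f : X ⟶ Y) :
    fibrations (NComplex (ModuleCat.{u} R) N) f ↔ ∀ i, Function.Surjective (app f i) :=
  forall_congr' fun _ => ModuleCat.epi_iff_surjective _

lemma trivialFibrations_iff (f : X ⟶ Y) :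
    trivialFibrations (NComplex (ModuleCat.{u} R) N) f ↔
      (∀ i, Function.Surjective (app f i)) ∧ quasiIso _ N f :=
  and_congr_left' (fibrations_iff f)

lemma surjective_fromContractible (Y : NComplex (ModuleCat.{u} R) N) (i : ℤ) :
    Function.Surjective (app (fromContractible Y) i) := fun y => by
  obtain ⟨s, hs⟩ := exists_section_fromContractible Y i
  exact ⟨_, hs y⟩

lemma isFibrant (X : NComplex (ModuleCat.{u} R) N) : IsFibrant X :=
  -- On the terminal object `0 = 𝟙`, so each of its elements is zero.
  ⟨(fibrations_iff (terminal.from X)).2 fun i y => ⟨0, by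
    have h : app (0 : ⊤_ NComplex (ModuleCat.{u} R) N ⟶ _) i y = app (𝟙 _) i y := by
      rw [Subsingleton.elim (0 : ⊤_ NComplex (ModuleCat.{u} R) N ⟶ _) (𝟙 _)]
    rw [map_zero]
    exact h⟩⟩

lemma isCofibrant_of_llp (h : (trivialFibrations (NComplex (ModuleCat.{u} R) N)).llp
    (initial.to X)) : IsCofibrant X := ⟨h⟩

lemma exists_lift_of_isCofibrant {E B : NComplex (ModuleCat.{u} R) N} (hX : IsCofibrant X)
    (p : E ⟶ B) (hp : ∀ i, Function.Surjective (app p i)) (hp' : quasiIso _ N p) (f : X ⟶ B) :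
    ∃ g : X ⟶ E, g ≫ p = f := by
  have := hX.mem p ((trivialFibrations_iff p).2 ⟨hp, hp'⟩)
  have sq : CommSq (initial.to E) (initial.to X) p f := ⟨Subsingleton.elim _ _⟩
  exact ⟨sq.lift, sq.fac_right⟩

/-- For acyclic `Y`, `fromContractible Y` is a trivial fibration, so every morphism to `Y` lifts
through a contractible object. -/
lemma isHProj_of_isCofibrant (hX : IsCofibrant X) : isHProj _ N ((toK _ N).obj X) :=
  isHProj_iff.2 fun Y hY f => by
    obtain ⟨g, hg⟩ := exists_lift_of_isCofibrant hX (fromContractible Y)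
      (surjective_fromContractible Y) (quasiIso_of_acyclic _ (disk_acyclic N _) hY) f
    exact (stableRel_iff_exists_lift _ _).2 ⟨g, by rw [hg, sub_zero]⟩

lemma quasiIso_biprod_inl (Y : NComplex (ModuleCat.{u} R) N) (M : ℤ → ModuleCat.{u} R) :
    quasiIso _ N (biprod.inl : Y ⟶ Y ⊞ disk N M) := by
  have : IsIso ((toK (ModuleCat.{u} R) N).map (biprod.inl : Y ⟶ Y ⊞ disk N M)) :=
    (toKBiprodDisk Y M).isIso_hom
  exact quasiIso_of_isIso_toK _

/-- The path object `Y ⊞ P`, where `P ⟶ Y` is a levelwise split epimorphism from a contractible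
`N`-complex. -/
@[simps]
def pathObject (Y : NComplex (ModuleCat.{u} R) N) : PathObject Y where
  P := Y ⊞ disk N (fun i => Y.obj.obj (i + 1 - N))
  p₀ := biprod.desc (𝟙 Y) (fromContractible Y)
  p₁ := biprod.fst
  ι := biprod.inl
  ι_p₀ := by simp
  ι_p₁ := by simp
  weakEquivalence_ι := ⟨quasiIso_biprod_inl Y _⟩

/-- Morphisms that agree in the homotopy category are right homotopic. -/
def pathObjectRightHomotopy (f g : X ⟶ Y)
    (a : X ⟶ disk N (fun i => Y.obj.obj (i + 1 - N)))
    (ha : a ≫ fromContractible Y = f - g) : (pathObject Y).RightHomotopy f g where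
  h := biprod.lift g a
  h₀ := by
    change _ ≫ biprod.desc _ _ = _
    rw [biprod.lift_desc, ha, Category.comp_id, add_sub_cancel]
  h₁ := biprod.lift_fst _ _

lemma app_prod_ext (i : ℤ) {x y : (X ⨯ Y : NComplex (ModuleCat.{u} R) N).obj.obj i}
    (h₁ : app prod.fst i x = app prod.fst i y) (h₂ : app prod.snd i x = app prod.snd i y) :
    x = y := by
  have h : 𝟙 (X ⨯ Y) = prod.fst ≫ prod.lift (𝟙 X) 0 + prod.snd ≫ prod.lift 0 (𝟙 Y) := by
    apply Limits.prod.hom_ext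
    · simp only [Preadditive.add_comp, Category.assoc, prod.lift_fst, Category.id_comp,
        Category.comp_id, comp_zero, add_zero]
    · simp only [Preadditive.add_comp, Category.assoc, prod.lift_snd, Category.id_comp,
        Category.comp_id, comp_zero, zero_add]
  change app (𝟙 (X ⨯ Y)) i x = app (𝟙 (X ⨯ Y)) i y
  rw [h, app_add, app_add, app_comp, app_comp, app_comp, app_comp, h₁, h₂]

lemma pathObject_isGood (Y : NComplex (ModuleCat.{u} R) N) : (pathObject Y).IsGood where
  fibration_p := ⟨(fibrations_iff
      (prod.lift (biprod.desc (𝟙 Y) (fromContractible Y)) biprod.fst)).2 fun i y => by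
    obtain ⟨z, hz⟩ := surjective_fromContractible Y i (app prod.fst i y - app prod.snd i y)
    refine ⟨app (biprod.inl : Y ⟶ Y ⊞ disk N _) i (app prod.snd i y) +
      app (biprod.inr : _ ⟶ Y ⊞ disk N _) i z, app_prod_ext i ?_ ?_⟩
    · rw [← app_comp, prod.lift_fst, map_add, ← app_comp biprod.inl, ← app_comp biprod.inr,
        biprod.inl_desc, biprod.inr_desc, hz, app_id, add_sub_cancel]
    · rw [← app_comp, prod.lift_snd, map_add, ← app_comp biprod.inl, ← app_comp biprod.inr,
        biprod.inl_fst, biprod.inr_fst, app_id, app_zero, add_zero]⟩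

lemma cfHomotopic_of_stableRel {X Y : CF (ModuleCat.{u} R) N} {f g : X ⟶ Y}
    (h : stableRel _ N f.hom g.hom) : cfHomotopic _ N f g := by
  obtain ⟨a, ha⟩ := (stableRel_iff_exists_lift _ _).1 h
  exact ⟨_, pathObject_isGood _, ⟨pathObjectRightHomotopy _ _ a ha⟩⟩

/-- In `K` the homotopy factors as `k ≫ P.ι`, because `P.ι` has acyclic cone and `X` is
h-projective; both ends then equal `k`. -/
lemma stableRel_of_rightHomotopy (hX : IsCofibrant X) (P : PathObject Y) {f g : X ⟶ Y}
    (h : P.RightHomotopy f g) : stableRel _ N f g := by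
  have h₁ : acyclicCone _ N ((toK _ N).map P.ι) :=
    acyclicCone_of_quasiIso _ P.weakEquivalence_ι.mem
  obtain ⟨k, hk⟩ := (acyclicCone_le_isColocal R N _ h₁ _ (isHProj_of_isCofibrant hX)).2
    ((toK _ N).map h.h)
  dsimp only at hk
  have h₂ (p : P.P ⟶ Y) (hp : P.ι ≫ p = 𝟙 Y) : (toK _ N).map (h.h ≫ p) = k := by
    rw [Functor.map_comp, ← hk, Category.assoc, ← Functor.map_comp, hp,
      CategoryTheory.Functor.map_id, Category.comp_id]
  rw [← toK_map_eq_iff]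
  exact (congr_arg _ h.h₀).symm.trans ((h₂ _ P.ι_p₀).trans
    ((h₂ _ P.ι_p₁).symm.trans (congr_arg _ h.h₁)))

lemma cfHomotopic_iff {X Y : CF (ModuleCat.{u} R) N} (f g : X ⟶ Y) :
    cfHomotopic _ N f g ↔ stableRel _ N f.hom g.hom := by
  refine ⟨?_, cfHomotopic_of_stableRel⟩
  rintro ⟨P, -, ⟨h⟩⟩
  exact stableRel_of_rightHomotopy X.property.1 P h

end Cofibrant

/-! ### Colimits of `N`-complexes and finitely presentable `N`-complexes -/

attribute [local instance] Cardinal.fact_isRegular_aleph0 Cardinal.orderBotAleph0OrdToType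

section Presentable

open Opposite

instance (J : Type*) [Category* J] [HasColimitsOfShape J (ModuleCat.{u} R)] :
    (isNComplex (ModuleCat.{u} R) N).IsClosedUnderColimitsOfShape J where
  colimitsOfShape_le := by
    rintro X ⟨p⟩ i
    have hl := isColimitOfPreserves ((evaluation ℤ (ModuleCat.{u} R)).obj i) p.isColimit
    refine hl.hom_ext fun j => ?_
    have h := (p.ι.app j).naturality (homOfLE (show i ≤ i + (N : ℤ) by lia))
    have h' := p.prop_diag_obj j i
    dsimp at h ⊢
    rw [← h, h']
    simp

instance : HasColimitsOfSize.{u, u} (NComplex (ModuleCat.{u} R) N) where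
  has_colimits_of_shape _ _ := inferInstance

variable (R) in
-- `Hom(R, -)` is the forgetful functor, which preserves filtered colimits.
lemma isFinitelyPresentable_self : IsFinitelyPresentable.{u} (ModuleCat.of R R) := by
  have : (forget (ModuleCat.{u} R)).IsFinitelyAccessible := by
    rw [Functor.isFinitelyAccessible_iff_preservesFilteredColimits]
    infer_instance
  let e (M : ModuleCat.{u} R) : M ≃ (ModuleCat.of R R ⟶ M) :=
    { toFun x := ModuleCat.ofHom (LinearMap.toSpanSingleton R M x)
      invFun f := f.hom (1 : R)
      left_inv x := by simp
      right_inv f := ModuleCat.hom_ext (LinearMap.ext_ring (by simp)) }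
  exact Functor.isCardinalAccessible_of_natIso (F := forget (ModuleCat.{u} R))
    (NatIso.ofComponents (fun M => (e M).toIso) (fun f => by
      ext x
      exact ModuleCat.hom_ext (LinearMap.ext_ring (by simp [e])))) _

lemma isFinitelyPresentable_of_obj (X : NComplex (ModuleCat.{u} R) N)
    [IsFinitelyPresentable.{u} X.obj] : IsFinitelyPresentable.{u} X := by
  have : (isNComplex (ModuleCat.{u} R) N).ι.IsFinitelyAccessible := ⟨fun J _ _ => inferInstance⟩
  exact Functor.isCardinalAccessible_of_natIso
    (F := (isNComplex (ModuleCat.{u} R) N).ι ⋙ coyoneda.obj (op X.obj))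
    (NatIso.ofComponents (fun Y => Equiv.toIso
      (isNComplex (ModuleCat.{u} R) N).fullyFaithfulι.homEquiv.symm) (fun f => by
        ext x
        rfl)) _

end Presentable

/-! ### Cells -/

section Free

variable (R) in
/-- The free functor on one generator in degree `i`. -/
def free (i : ℤ) : ℤ ⥤ ModuleCat.{u} R :=
  (evaluationLeftAdjoint (ModuleCat.{u} R) i).obj (ModuleCat.of R R)

variable (R) in
/-- The generator of the free functor. -/
def freeGen (i : ℤ) : (free R i).obj i :=
  (Sigma.ι (fun _ : i ⟶ i => ModuleCat.of R R) (𝟙 i)).hom (1 : R)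

variable {X Y : ℤ ⥤ ModuleCat.{u} R}

/-- The morphism from the free functor given by the image of the generator. -/
def freeDesc (i : ℤ) (x : X.obj i) : free R i ⟶ X :=
  ((evaluationAdjunctionRight (ModuleCat.{u} R) i).homEquiv _ _).symm
    (ModuleCat.ofHom (LinearMap.toSpanSingleton R _ x))

lemma freeDesc_freeGen (i : ℤ) (x : X.obj i) : (freeDesc i x).app i (freeGen R i) = x := by
  have h := ((evaluationAdjunctionRight (ModuleCat.{u} R) i).homEquiv _ X).apply_symm_apply
    (ModuleCat.ofHom (LinearMap.toSpanSingleton R _ x))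
  have h' := congr(($h).hom (1 : R))
  simp only [ModuleCat.hom_ofHom, LinearMap.toSpanSingleton_apply, one_smul] at h'
  exact h'

lemma free_hom_ext {i : ℤ} {f g : free R i ⟶ X}
    (h : f.app i (freeGen R i) = g.app i (freeGen R i)) : f = g := by
  refine ((evaluationAdjunctionRight (ModuleCat.{u} R) i).homEquiv _ X).injective ?_
  exact ModuleCat.hom_ext (LinearMap.ext_ring h)

lemma free_obj_hom_ext {i k : ℤ} {M : ModuleCat.{u} R} {f g : (free R i).obj k ⟶ M}
    (h : ∀ φ : i ⟶ k, f ((free R i).map φ (freeGen R i)) = g ((free R i).map φ (freeGen R i))) :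
    f = g := by
  refine Sigma.hom_ext _ _ fun φ => ModuleCat.hom_ext (LinearMap.ext_ring ?_)
  have : (free R i).map φ (freeGen R i) =
      (Sigma.ι (fun _ : i ⟶ k => ModuleCat.of R R) φ).hom (1 : R) := by
    have h' : Sigma.ι (fun _ : i ⟶ i => ModuleCat.of R R) (𝟙 i) ≫ (free R i).map φ =
        Sigma.ι (fun _ : i ⟶ k => ModuleCat.of R R) φ := by
      refine (Sigma.ι_desc _ _).trans ?_
      rw [Category.id_comp]
    exact congr(($h').hom (1 : R))
  have h' := h φ
  rw [this] at h'
  exact h'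

variable (R) in
lemma isFinitelyPresentable_free (i : ℤ) : IsFinitelyPresentable.{u} (free R i) := by
  have := isFinitelyPresentable_self R
  exact (evaluationAdjunctionRight (ModuleCat.{u} R) i).isCardinalPresentable_leftAdjoint_obj _ _

/-- The relation `dʲ⁻ⁱ = 0` on the generator of a free functor. -/
def freeRel {i j : ℤ} (h : i ≤ j) : free R j ⟶ free R i :=
  freeDesc j ((free R i).map (homOfLE h) (freeGen R i))

variable (R) in
/-- The functor generated by one element in degree `i` that is annihilated in degree `j`. -/
def cellFunctor {i j : ℤ} (h : i ≤ j) : ℤ ⥤ ModuleCat.{u} R :=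
  cokernel (freeRel (R := R) h)

/-- The projection from the free functor to the cell. -/
def cellπ {i j : ℤ} (h : i ≤ j) : free R i ⟶ cellFunctor R h :=
  cokernel.π (freeRel (R := R) h)

lemma freeRel_cellπ {i j : ℤ} (h : i ≤ j) : freeRel h ≫ cellπ (R := R) h = 0 :=
  cokernel.condition _

lemma cellπ_relation {i j : ℤ} (h : i ≤ j) :
    (cellFunctor R h).map (homOfLE h) ((cellπ h).app i (freeGen R i)) = 0 := by
  have h' := congr(($(freeRel_cellπ (R := R) h)).app j (freeGen R j))
  rw [← NatTrans.naturality_apply]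
  have h'' : (freeRel h).app j (freeGen R j) = (free R i).map (homOfLE h) (freeGen R i) :=
    freeDesc_freeGen _ _
  rw [← h'']
  exact h'

/-- Degree `k` is generated by the image of the generator, and `k + N ≥ i + N ≥ j`, so `d ^ N`
passes through the relation in degree `j`. -/
lemma isNComplex_cellFunctor {i j : ℤ} (h : i ≤ j) (hj : j ≤ i + N) :
    isNComplex (ModuleCat.{u} R) N (cellFunctor R h) := fun k => by
  have : Epi (cellπ (R := R) h) := inferInstanceAs (Epi (cokernel.π _))
  rw [← cancel_epi ((cellπ h).app k), comp_zero, ← NatTrans.naturality]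
  refine free_obj_hom_ext fun φ => ?_
  have hk := leOfHom φ
  have h₁ := congr((cellπ h).app _ ($((free R i).map_comp φ (homOfLE (show k ≤ k + N by lia)))
    (freeGen R i)))
  have h₂ := congr($((cellFunctor R h).map_comp (homOfLE h)
    (homOfLE (show j ≤ k + N by lia))) ((cellπ h).app i (freeGen R i)))
  rw [ModuleCat.comp_apply, cellπ_relation, map_zero] at h₂
  change (cellπ h).app _ ((free R i).map _ ((free R i).map φ (freeGen R i))) = 0
  rw [← h₂, ← NatTrans.naturality_apply]
  exact h₁.symm

lemma isFinitelyPresentable_cellFunctor {i j : ℤ} (h : i ≤ j) :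
    IsFinitelyPresentable.{u} (cellFunctor R h) := by
  have (k : WalkingParallelPair) :
      IsFinitelyPresentable.{u} ((parallelPair (freeRel (R := R) h) 0).obj k) := by
    have := isFinitelyPresentable_free R
    cases k <;> exact this _
  refine isCardinalPresentable_of_isColimit' _ (cokernelIsCokernel (freeRel (R := R) h)) _ ?_
  rw [hasCardinalLT_aleph0_iff]
  infer_instance

end Free

section Cell

variable (R N) in
/-- The `N`-complex generated by one element in degree `i` that is annihilated in degree `j`. -/
def cell {i j : ℤ} (h : i ≤ j) (hj : j ≤ i + N) : NComplex (ModuleCat.{u} R) N :=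
  ⟨cellFunctor R h, isNComplex_cellFunctor h hj⟩

variable {X Y : NComplex (ModuleCat.{u} R) N} {i j : ℤ} (h : i ≤ j) (hj : j ≤ i + N)

variable (R N) in
/-- The generator of a cell. -/
def cellGen : (cell R N h hj).obj.obj i := (cellπ h).app i (freeGen R i)

lemma d_cellGen : (cell R N h hj).d h (cellGen R N h hj) = 0 :=
  cellπ_relation h

include h in
lemma freeRel_freeDesc (x : X.obj.obj i) (hx : X.d h x = 0) : freeRel h ≫ freeDesc i x = 0 :=
  free_hom_ext (by
    change (freeDesc i x).app j ((freeRel h).app j (freeGen R j)) = 0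
    have h' : (freeRel h).app j (freeGen R j) = (free R i).map (homOfLE h) (freeGen R i) :=
      freeDesc_freeGen _ _
    rw [h', NatTrans.naturality_apply, freeDesc_freeGen]
    exact hx)

/-- The morphism from a cell given by the image of the generator. -/
def cellDesc (x : X.obj.obj i) (hx : X.d h x = 0) : cell R N h hj ⟶ X :=
  ObjectProperty.homMk (cokernel.desc _ (freeDesc i x) (freeRel_freeDesc h x hx))

lemma app_cellDesc (x : X.obj.obj i) (hx : X.d h x = 0) :
    app (cellDesc h hj x hx) i (cellGen R N h hj) = x :=
  congr(NatTrans.app $(cokernel.π_desc (freeRel h) (freeDesc i x)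
    (freeRel_freeDesc h x hx)) i (freeGen R i)).trans (freeDesc_freeGen i x)

lemma cell_hom_ext {f g : cell R N h hj ⟶ X}
    (hfg : app f i (cellGen R N h hj) = app g i (cellGen R N h hj)) : f = g := by
  have : Epi (cellπ (R := R) h) := inferInstanceAs (Epi (cokernel.π _))
  exact ObjectProperty.hom_ext _ ((cancel_epi (cellπ h)).1 (free_hom_ext hfg))

lemma isFinitelyPresentable_cell : IsFinitelyPresentable.{u} (cell R N h hj) := by
  have : IsFinitelyPresentable.{u} (cell R N h hj).obj := isFinitelyPresentable_cellFunctor h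
  exact isFinitelyPresentable_of_obj _

end Cell

/-! ### Cofibrant replacements -/

section SmallObject

open MorphismProperty

variable {X Y : NComplex (ModuleCat.{u} R) N}

variable (R) in
/-- For `a ≤ b ≤ a + N`, the morphism from the cell generated by an element in degree `b` to the
cell generated by an element in degree `a`, both annihilated in degree `a + N`. -/
def cellMap {a b : ℤ} (hab : a ≤ b) (hb : b ≤ a + N) :
    cell R N hb (by lia) ⟶ cell R N (show a ≤ a + N by lia) le_rfl :=
  cellDesc _ _ ((cell R N (show a ≤ a + N by lia) le_rfl).d hab (cellGen R N _ _))
    (by rw [d_d, d_cellGen])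

lemma app_cellMap {a b : ℤ} (hab : a ≤ b) (hb : b ≤ a + N) :
    app (cellMap R hab hb) b (cellGen R N hb (by lia)) =
      (cell R N (show a ≤ a + N by lia) le_rfl).d hab (cellGen R N _ _) :=
  app_cellDesc _ _ _ _

variable (R N) in
/-- The generating cofibrations. -/
def generatingCofibrations : MorphismProperty (NComplex (ModuleCat.{u} R) N) :=
  ofHoms fun p : {p : ℤ × ℤ // p.1 ≤ p.2 ∧ p.2 ≤ p.1 + N} => cellMap R p.2.1 p.2.2

lemma generatingCofibrations_cellMap {a b : ℤ} (hab : a ≤ b) (hb : b ≤ a + N) :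
    generatingCofibrations R N (cellMap R hab hb) :=
  ofHoms.mk (f := fun p : {p : ℤ × ℤ // p.1 ≤ p.2 ∧ p.2 ≤ p.1 + N} => cellMap R p.2.1 p.2.2)
    ⟨(a, b), hab, hb⟩

instance : IsSmall.{u} (generatingCofibrations R N) :=
  isSmall_ofHoms ..

instance : IsCardinalForSmallObjectArgument (generatingCofibrations R N) Cardinal.aleph0.{u} where
  preservesColimit {A B X Y} i hi f hf := by
    have : IsFinitelyPresentable.{u} A := by
      obtain ⟨p⟩ := hi
      exact isFinitelyPresentable_cell _ _
    infer_instance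

instance : HasSmallObjectArgument.{u} (generatingCofibrations R N) :=
  ⟨.aleph0, inferInstance, inferInstance, inferInstance⟩

/-- Lifting squares are read off from the universal property of cells; `b = a + N` forces `x = 0`
and amounts to surjectivity in degree `a`. -/
lemma generatingCofibrations_rlp_iff (f : X ⟶ Y) :
    (generatingCofibrations R N).rlp f ↔
      ∀ (a b : ℤ) (hab : a ≤ b) (hb : b ≤ a + N) (x : X.obj.obj b) (y : Y.obj.obj a),
        X.d hb x = 0 → app f b x = Y.d hab y →
          ∃ z : X.obj.obj a, app f a z = y ∧ X.d hab z = x := by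
  refine ⟨fun h a b hab hb x y hx hxy => ?_, fun h => ?_⟩
  · have := h _ (generatingCofibrations_cellMap hab hb)
    have sq : CommSq (cellDesc hb (by lia) x hx) (cellMap R hab hb) f
        (cellDesc (show a ≤ a + N by lia) le_rfl y (d_eq_zero _ le_rfl _)) :=
      ⟨cell_hom_ext _ _ (by
        rw [app_comp, app_comp, app_cellDesc, app_cellMap, app_d, app_cellDesc, hxy])⟩
    refine ⟨app sq.lift a (cellGen R N _ _), ?_, ?_⟩
    · rw [← app_comp, sq.fac_right, app_cellDesc]
    · have h' := congr(app $(sq.fac_left) b (cellGen R N hb (by lia)))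
      rwa [app_comp, app_cellMap, app_cellDesc, app_d] at h'
  · rintro _ _ _ ⟨⟨⟨a, b⟩, hab, hb⟩⟩
    refine ⟨fun {u v} sq => ?_⟩
    obtain ⟨z, hz, hz'⟩ := h a b hab hb (app u b (cellGen R N _ _)) (app v a (cellGen R N _ _))
      (by rw [← app_d, d_cellGen, map_zero])
      (by rw [← app_comp, sq.w, app_comp, app_cellMap, app_d])
    refine ⟨⟨cellDesc _ _ z (d_eq_zero _ le_rfl _), cell_hom_ext _ _ ?_, cell_hom_ext _ _ ?_⟩⟩
    · rw [app_comp, app_cellMap, app_d, app_cellDesc, hz']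
    · rw [app_comp, app_cellDesc, hz]

lemma trivialFibrations_le_rlp :
    trivialFibrations (NComplex (ModuleCat.{u} R) N) ≤ (generatingCofibrations R N).rlp := by
  intro X Y f hf
  obtain ⟨hf, hf'⟩ := (trivialFibrations_iff f).1 hf
  rw [generatingCofibrations_rlp_iff]
  intro a b hab hb x y hx hxy
  obtain ⟨y, rfl⟩ := hf a y
  obtain rfl | hab' := hab.eq_or_lt
  · exact ⟨x, by simpa using hxy, by simp⟩
  rw [quasiIso_iff] at hf'
  -- the cycle `k` measures the failure of `y` to be a solution
  obtain ⟨k, hk⟩ : ∃ k, k = x - X.d hab y := ⟨_, rfl⟩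
  have hk₁ : app f b k = 0 := by rw [hk, map_sub, hxy, app_d, sub_self]
  have hk₂ : X.d hb k = 0 := by rw [hk, map_sub, hx, d_d, d_eq_zero _ le_rfl, sub_zero]
  suffices ∃ l : X.obj.obj a, app f a l = 0 ∧ X.d hab l = k by
    obtain ⟨l, hl, hl'⟩ := this
    exact ⟨y + l, by rw [map_add, hl, add_zero], by rw [map_add, hl', hk, add_sub_cancel]⟩
  obtain rfl | hb' := hb.eq_or_lt
  · rw [d_self] at hk₂
    exact ⟨0, by simp, by rw [hk₂, map_zero]⟩
  -- Injectivity on cohomology gives `k = d t`. Then `f t` is a cycle in the window `b - N, a, b`,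
  -- and surjectivity there lets `t` be moved into the kernel of `f` without changing `d t`.
  obtain ⟨t, rfl⟩ := (hf' a b (a + N) hab' hb' rfl).1 k 0 hk₂ (by rw [hk₁, map_zero])
  obtain ⟨s, w, hs, hw⟩ := (hf' (b - N) a b (by lia) hab' (by lia)).2 (app f a t)
    (by rw [← app_d, hk₁])
  obtain ⟨w, rfl⟩ := hf _ w
  refine ⟨t - s - X.d (by lia) w, ?_, ?_⟩
  · rw [map_sub, map_sub, hw, app_d]
    abel
  · rw [map_sub, map_sub, hs, d_d, d_eq_zero (show b - N ≤ b by lia) (by lia), sub_zero, sub_zero]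

lemma quasiIso_of_rlp (f : X ⟶ Y) (hf : (generatingCofibrations R N).rlp f) :
    quasiIso _ N f := by
  rw [generatingCofibrations_rlp_iff] at hf
  refine (quasiIso_iff f).2 fun a b c hab hbc hac => ⟨fun x y hx hxy => ?_, fun y hy => ?_⟩
  · subst hac
    obtain ⟨z, -, hz⟩ := hf a b hab.le hbc.le x y hx hxy
    exact ⟨z, hz.symm⟩
  -- Taking `x = 0` lifts the cycle `y` to a cycle.
  · obtain ⟨z, hz, hz'⟩ := hf b c hbc.le (by lia) 0 y (map_zero _) (by rw [hy, map_zero])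
    exact ⟨z, 0, hz', by rw [hz, map_zero, add_zero]⟩

lemma exists_cofibrant_replacement (Y : NComplex (ModuleCat.{u} R) N) :
    ∃ (X : NComplex (ModuleCat.{u} R) N) (f : X ⟶ Y), IsCofibrant X ∧ quasiIso _ N f := by
  let h := factorizationData (generatingCofibrations R N).rlp.llp
    (generatingCofibrations R N).rlp (initial.to Y)
  refine ⟨h.Z, h.p, isCofibrant_of_llp ?_, quasiIso_of_rlp _ h.hp⟩
  rw [Subsingleton.elim (initial.to h.Z) h.i]
  exact antitone_llp trivialFibrations_le_rlp _ h.hi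

end SmallObject

end NComplex

namespace CategoryTheory

/-! ### Localizations and colocal objects -/

section Colocal

variable {C : Type*} [Category* C] (P : ObjectProperty C) (W : MorphismProperty C)

/-- The replacements `f X` are the counit of a right adjoint `G` of the inclusion. `G` inverts `W`
and its counit lies in `W`, so `G` is itself a localization at `W`, with the inclusion as
quasi-inverse after localizing. -/
lemma ObjectProperty.isEquivalence_ι_comp_Q (hW : W ≤ P.isColocal)
    (h : ∀ X, ∃ (Y : C) (_ : P Y) (f : Y ⟶ X), W f) : (P.ι ⋙ W.Q).IsEquivalence := by
  choose Y hY f hf using h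
  let e (X : P.FullSubcategory) (Z : C) : (P.ι.obj X ⟶ Z) ≃ (X ⟶ ⟨Y Z, hY Z⟩) :=
    ((hW _ (hf Z)).homEquiv X.obj X.property).symm.trans
      (P.fullyFaithfulι.homEquiv (X := X) (Y := ⟨Y Z, hY Z⟩)).symm
  have he (X : P.FullSubcategory) (Z : C) (g : X ⟶ ⟨Y Z, hY Z⟩) : (e X Z).symm g = g.hom ≫ f Z :=
    rfl
  have he' (X' X : P.FullSubcategory) (Z : C) (k : X' ⟶ X) (g : P.ι.obj X ⟶ Z) :
      e X' Z (P.ι.map k ≫ g) = k ≫ e X Z g := by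
    rw [← Equiv.eq_symm_apply, he]
    obtain ⟨g, rfl⟩ := (e X Z).symm.surjective g
    rw [Equiv.apply_symm_apply, he]
    exact (Category.assoc _ _ _).symm
  let G : C ⥤ P.FullSubcategory := Adjunction.rightAdjointOfEquiv e he'
  let adj : P.ι ⊣ G := Adjunction.adjunctionOfEquivRight e he'
  have hcounit (X : C) : adj.counit.app X = f X := by
    change (e _ X).symm (𝟙 _) = _
    rw [he]
    exact Category.id_comp _
  have hG : W.IsInvertedBy G := fun X Z w hw => by
    have h₁ : P.ι.map (G.map w) ≫ f Z = f X ≫ w := by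
      rw [← hcounit, ← hcounit]
      exact adj.counit.naturality w
    have h₂ : P.isColocal (P.ι.map (G.map w)) :=
      P.isColocal.of_postcomp _ (f Z) (hW _ (hf Z))
        (h₁ ▸ P.isColocal.comp_mem _ _ (hW _ (hf X)) (hW _ hw))
    rw [ObjectProperty.isColocal_iff_isIso _ _ (hY X) (hY Z)] at h₂
    exact isIso_of_fully_faithful P.ι _
  have := adj.isLocalization_rightAdjoint W hG (fun X => by
    rw [hcounit]
    exact hf X)
  let E := Localization.uniq W.Q G W
  have i : (P.ι ⋙ W.Q) ⋙ E.functor ≅ 𝟭 _ :=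
    Functor.associator _ _ _ ≪≫ Functor.isoWhiskerLeft _ (Localization.compUniqFunctor W.Q G W) ≪≫
      (asIso adj.unit).symm
  have : ((P.ι ⋙ W.Q) ⋙ E.functor).IsEquivalence := Functor.isEquivalence_of_iso i.symm
  exact Functor.isEquivalence_of_comp_right _ E.functor

end Colocal

end CategoryTheory

/-! ### The equivalences and the localization of `C_N` at quasi-isomorphisms -/

namespace NComplex

variable (R : Type u) [Ring R] (N : ℕ)

lemma exists_hProj_replacement (X : K (ModuleCat.{u} R) N) :
    ∃ (Y : K (ModuleCat.{u} R) N) (_ : isHProj _ N Y) (f : Y ⟶ X), acyclicCone _ N f := by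
  obtain ⟨Y, f, hY, hf⟩ := exists_cofibrant_replacement X.as
  exact ⟨(toK _ N).obj Y, isHProj_of_isCofibrant hY, (toK _ N).map f, acyclicCone_of_quasiIso f hf⟩

lemma isEquivalence_hProjι_toD :
    (hProjι (ModuleCat.{u} R) N ⋙ toD (ModuleCat.{u} R) N).IsEquivalence :=
  ObjectProperty.isEquivalence_ι_comp_Q _ _ (acyclicCone_le_isColocal R N)
    (exists_hProj_replacement R N)

/-- Right homotopic morphisms become equal in the localization. -/
lemma map_eq_of_rightHomotopy {C : Type*} [Category* C] (L : NComplex (ModuleCat.{u} R) N ⥤ C)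
    (hL : (quasiIso (ModuleCat.{u} R) N).IsInvertedBy L) {X Y : NComplex (ModuleCat.{u} R) N}
    (P : PathObject Y) {f g : X ⟶ Y} (h : P.RightHomotopy f g) : L.map f = L.map g := by
  have : IsIso (L.map P.ι) := hL _ P.weakEquivalence_ι.mem
  have h₁ : L.map P.p₀ = L.map P.p₁ := by
    rw [← cancel_epi (L.map P.ι), ← L.map_comp, ← L.map_comp, P.ι_p₀, P.ι_p₁]
  exact (congr_arg L.map h.h₀).symm.trans
    (((L.map_comp _ _).trans (congr_arg (L.map h.h ≫ ·) h₁)).trans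
      ((L.map_comp _ _).symm.trans (congr_arg L.map h.h₁)))

lemma factorsThroughLocalization_stableRel :
    (stableRel (ModuleCat.{u} R) N).FactorsThroughLocalization (quasiIso (ModuleCat.{u} R) N) :=
  fun X Y f g h => by
    rw [areEqualizedByLocalization_iff (quasiIso (ModuleCat.{u} R) N).Q]
    obtain ⟨a, ha⟩ := (stableRel_iff_exists_lift _ _).1 h
    exact map_eq_of_rightHomotopy R N _ (Localization.inverts _ _) _
      (pathObjectRightHomotopy f g a ha)

lemma isLocalization_toK_toD :
    (toK (ModuleCat.{u} R) N ⋙ toD (ModuleCat.{u} R) N).IsLocalization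
      (quasiIso (ModuleCat.{u} R) N) :=
  Functor.IsLocalization.mk' _ _
    ((factorsThroughLocalization_stableRel R N).strictUniversalPropertyFixedTarget'
      (quasiIso_eq_inverseImage R N) _)
    ((factorsThroughLocalization_stableRel R N).strictUniversalPropertyFixedTarget'
      (quasiIso_eq_inverseImage R N) _)

/-- The functor from fibrant-cofibrant `N`-complexes to h-projective `N`-complexes. -/
def cfToHProj : CF (ModuleCat.{u} R) N ⥤ HProj (ModuleCat.{u} R) N :=
  ObjectProperty.lift _ (cfι (ModuleCat.{u} R) N ⋙ toK (ModuleCat.{u} R) N)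
    fun X => isHProj_of_isCofibrant X.property.1

lemma cfToHProj_map_eq_iff {X Y : CF (ModuleCat.{u} R) N} (f g : X ⟶ Y) :
    (cfToHProj R N).map f = (cfToHProj R N).map g ↔ cfHomotopic _ N f g := by
  rw [cfHomotopic_iff, ← toK_map_eq_iff]
  exact (hProjι (ModuleCat.{u} R) N).map_injective.eq_iff.symm

instance : (cfToHProj R N).Full := inferInstanceAs (ObjectProperty.lift _ _ _).Full

instance : (cfToHProj R N).EssSurj where
  mem_essImage P := by
    obtain ⟨X, f, hX, hf⟩ := exists_cofibrant_replacement P.obj.as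
    -- A colocal morphism between h-projective objects is invertible, by Yoneda.
    have h := acyclicCone_le_isColocal R N _ (acyclicCone_of_quasiIso f hf)
    let φ : (toK _ N).obj X ⟶ P.obj := (toK _ N).map f
    have : IsIso φ :=
      (ObjectProperty.isColocal_iff_isIso _ φ (isHProj_of_isCofibrant hX) P.property).1 h
    let ψ : (toK _ N).obj X ≅ P.obj := asIso φ
    exact ⟨⟨X, hX, isFibrant X⟩, ⟨ObjectProperty.isoMk _ ψ⟩⟩

/-- The functor from the homotopy category of the model structure to h-projective
`N`-complexes. -/
def hoToHProj : Ho (ModuleCat.{u} R) N ⥤ HProj (ModuleCat.{u} R) N :=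
  CategoryTheory.Quotient.lift _ (cfToHProj R N) fun _ _ f g h => (cfToHProj_map_eq_iff R N f g).2 h

instance : (hoToHProj R N).IsEquivalence where
  faithful := ⟨by
    rintro X Y f g h
    obtain ⟨f, rfl⟩ := (toHo (ModuleCat.{u} R) N).map_surjective (X := X.as) (Y := Y.as) f
    obtain ⟨g, rfl⟩ := (toHo (ModuleCat.{u} R) N).map_surjective (X := X.as) (Y := Y.as) g
    exact CategoryTheory.Quotient.sound _ ((cfToHProj_map_eq_iff R N f g).1 h)⟩
  full := ⟨fun {X Y} f => by
    obtain ⟨f, rfl⟩ := (cfToHProj R N).map_surjective (X := X.as) (Y := Y.as) f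
    exact ⟨(toHo (ModuleCat.{u} R) N).map f, rfl⟩⟩
  essSurj := ⟨fun P => by
    obtain ⟨X, ⟨e⟩⟩ := Functor.EssSurj.mem_essImage (F := cfToHProj R N) P
    exact ⟨(toHo (ModuleCat.{u} R) N).obj X, ⟨e⟩⟩⟩

/-- The functor from the homotopy category of the model structure to the localization. -/
def hoToLocalization :
    Ho (ModuleCat.{u} R) N ⥤ (quasiIso (ModuleCat.{u} R) N).Localization :=
  CategoryTheory.Quotient.lift _ (cfι (ModuleCat.{u} R) N ⋙ (quasiIso (ModuleCat.{u} R) N).Q) (by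
    rintro X Y f g ⟨P, -, ⟨h⟩⟩
    exact map_eq_of_rightHomotopy R N (quasiIso (ModuleCat.{u} R) N).Q
      (Localization.inverts _ _) P h)

instance : (hoToLocalization R N).IsEquivalence := by
  let W := quasiIso (ModuleCat.{u} R) N
  let L := toK (ModuleCat.{u} R) N ⋙ toD (ModuleCat.{u} R) N
  have : L.IsLocalization W := isLocalization_toK_toD R N
  have := isEquivalence_hProjι_toD R N
  let E := Localization.uniq L W.Q W
  -- Uniqueness of localizations identifies the functor with a composite of three known
  -- equivalences.
  let e : hoToHProj R N ⋙ (hProjι (ModuleCat.{u} R) N ⋙ toD (ModuleCat.{u} R) N) ⋙ E.functor ≅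
      hoToLocalization R N :=
    CategoryTheory.Quotient.natIsoLift _
      (Functor.isoWhiskerLeft (cfι (ModuleCat.{u} R) N) (Localization.compUniqFunctor L W.Q W))
  exact Functor.isEquivalence_of_iso e

end NComplex

end

theorem mainTheorem12 (R : Type u) [Ring R] (N : ℕ) :
    (NComplex.hProjι (ModuleCat.{u} R) N ⋙ NComplex.toD (ModuleCat.{u} R) N).IsEquivalence ∧
    (∃ F : NComplex.Ho (ModuleCat.{u} R) N ⥤ NComplex.HProj (ModuleCat.{u} R) N,
      NComplex.toHo (ModuleCat.{u} R) N ⋙ F ⋙ NComplex.hProjι (ModuleCat.{u} R) N =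
        NComplex.cfι (ModuleCat.{u} R) N ⋙ NComplex.toK (ModuleCat.{u} R) N ∧
      F.IsEquivalence) ∧
    (∃ G : NComplex.Ho (ModuleCat.{u} R) N ⥤
        (NComplex.quasiIso (ModuleCat.{u} R) N).Localization,
      NComplex.toHo (ModuleCat.{u} R) N ⋙ G =
        NComplex.cfι (ModuleCat.{u} R) N ⋙ (NComplex.quasiIso (ModuleCat.{u} R) N).Q ∧
      G.IsEquivalence) ∧
    (NComplex.toK (ModuleCat.{u} R) N ⋙ NComplex.toD (ModuleCat.{u} R) N).IsLocalization
      (NComplex.quasiIso (ModuleCat.{u} R) N) :=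
  ⟨NComplex.isEquivalence_hProjι_toD R N, ⟨NComplex.hoToHProj R N, rfl, inferInstance⟩,
    ⟨NComplex.hoToLocalization R N, rfl, inferInstance⟩, NComplex.isLocalization_toK_toD R N⟩
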